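/- **Setting.** Let $d\in\mathbb N$ and fix an even $\eta\in C_0^\infty(\mathbb R)$, non-increasing on $[0,\infty)$, with $\mathbf 1_{[-4/3,4/3]}\le\eta\le\mathbf 1_{[-5/3,5/3]}$. Put $\eta_0=\eta$ and $\eta_i(x)=\eta(x/2^i)-\eta(x/2^{i-1})$ for $i\ge1$. Let $\mathcal F_x,\mathcal F_{t,x}$ be the unitary Fourier transforms with kernels $e^{-ix\cdot\xi}$, $e^{-ix\cdot\xi-it\tau}$. Let $N$ run over $2^{\mathbb N_0}$; put $I_1=\{|\xi|\le2\}$, $I_N=\{N/2\le|\xi|\le2N\}$ for $N\ge2$, and let $P_N$ be the Fourier multiplier with symbol $\eta(|\xi|)$ if $N=1$ and $\eta(|\xi|/N)-\eta(2|\xi|/N)$ if $N\ge2$. For $\sigma\in\mathbb R\setminus\{0\}$, $a>0$, $T\in(0,1]$, $s\in\mathbb R$ define $$\|F\|_{X_{N,\sigma}}=\sum_{i\ge0}2^{i/2}\|\eta_i(\tau+\sigma|\xi|^2)F(\tau,\xi)\|_{L^2_{\tau,\xi}},\qquad \|u\|_{F^a_{N,\sigma,T}}=\sup_{t_N\in\mathbb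 R}\big\|\mathcal F_{t,x}[\eta_0(N^aT^{-1}(t-t_N))u]\big\|_{X_{N,\sigma}},$$ and let $F^a_{N,\sigma,T}$ be the set of $u\in C(\mathbb R;L^2(\mathbb R^d))$ that vanish for $t\notin[-4,4]$, have $\mathcal F_{t,x}[u]$ supported in $\mathbb R\times I_N$, and have $\|u\|_{F^a_{N,\sigma,T}}<\infty$. Let $\|v\|_{F^a_{N,\sigma}(T)}$ be the infimum of $\|u\|_{F^a_{N,\sigma,T}}$ over all $u\in F^a_{N,\sigma,T}$ with $u=v$ on $[0,T]$ ($\infty$ if there is none), and $$F^{s,a}_\sigma(T)=\Big\{u\in C([0,T];H^s(\mathbb R^d)) : \|u\|_{F^{s,a}_\sigma(T)}=\Big(\sum_N N^{2s}\|P_Nu\|_{F^a_{N,\sigma}(T)}^2\Big)^{1/2}<\infty\Big\}.$$ **Lemma.** Let $d\in\mathbb N$ and let $\alpha,\beta,\gamma\in\mathbb R\setminus\{0\}$ satisfy $\alpha-\gamma=0$ and $\beta+\gamma\ne0$. Then for all $0<a<1$, $s\in\mathbb R$, $T\in(0,1]$, $1\le j\le d$, $C>0$ and $N_0\in2^{\mathbb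 N_0}$ there exist a dyadic $N\ge N_0$ and $f\in F^{s,a}_\alpha(T)\cap C([0,T];L^2)$, $g\in F^{s,a}_\beta(T)\cap C([0,T];L^2)$ such that for every $t\in[0,T]$ the function $\mathcal F_x[f(t)]$ is supported in $I_N$ and $\mathcal F_x[g(t)]$ is supported in $I_1$, and $$C\,\|f\|_{F^{s,a}_\alpha(T)}\|g\|_{F^{s,a}_\beta(T)}<\sup_{t\in[0,T]}\Big\|\int_0^te^{i(t-t')\gamma\Delta}\partial_{x_j}(f\bar g)(t')\,dt'\Big\|_{H^s(\mathbb R^d)}<\infty .$$ In particular, the Duhamel term cannot be bounded in $H^s$ by $C\|f\|_{F^{s,a}_\alpha(T)}\|g\|_{F^{s,a}_\beta(T)}$ for any $s$ and $C$, already for High$\times$Low$\to$High interactions. -/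

import Mathlib

open MeasureTheory Set Filter Topology FourierTransform TemperedDistribution
open scoped SchwartzMap ENNReal LineDeriv ContDiff

noncomputable section

namespace ShortTime

/-- The physical space `ℝ^d` with its Euclidean norm. -/
abbrev Space (d : ℕ) : Type := EuclideanSpace ℝ (Fin d)

/-- Complex-valued `L²(ℝ^d)`. -/
abbrev L2 (d : ℕ) : Type := Lp ℂ 2 (volume : Measure (Space d))

/-- Admissible bump functions: smooth, even, non-increasing on `[0, ∞)`, and
`1_{[-4/3, 4/3]} ≤ η ≤ 1_{[-5/3, 5/3]}`. -/
structure IsBump (η : ℝ → ℝ) : Prop where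
  smooth : ContDiff ℝ ∞ η
  even : ∀ x, η (-x) = η x
  antitone : AntitoneOn η (Ici 0)
  lower : ∀ x, indicator (Icc (-(4 / 3)) (4 / 3)) (fun _ => (1 : ℝ)) x ≤ η x
  upper : ∀ x, η x ≤ indicator (Icc (-(5 / 3)) (5 / 3)) (fun _ => (1 : ℝ)) x

/-- The modulation cutoffs `η_j`. -/
def etaJ (η : ℝ → ℝ) (j : ℕ) (x : ℝ) : ℝ :=
  if j = 0 then η x else η (x / 2 ^ j) - η (x / 2 ^ (j - 1))

/-- The Littlewood-Paley symbol `ψ_N` for `N = 2 ^ k`. -/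
def psi (η : ℝ → ℝ) {d : ℕ} (k : ℕ) (ξ : Space d) : ℝ :=
  if k = 0 then η ‖ξ‖ else η (‖ξ‖ / 2 ^ k) - η (2 * ‖ξ‖ / 2 ^ k)

/-- The frequency region `I_N` for `N = 2 ^ k`: the ball of radius `2` for `N = 1`, the annulus
`N / 2 ≤ |ξ| ≤ 2 N` for `N ≥ 2`. -/
def freqRegion (d : ℕ) (k : ℕ) : Set (Space d) :=
  if k = 0 then {ξ | ‖ξ‖ ≤ 2} else {ξ | 2⁻¹ * 2 ^ k ≤ ‖ξ‖ ∧ ‖ξ‖ ≤ 2 * 2 ^ k}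

/-- `F_x[u](ξ) = (2π)^{-d/2} ∫ u(x) e^{-i x · ξ} dx` on `L²`, through the library's Fourier
transform `𝓕`, which uses the kernel `e^{-2π i x · ξ}`. -/
def spaceFourier {d : ℕ} (u : L2 d) (ξ : Space d) : ℂ :=
  (((2 * Real.pi) ^ (-(d : ℝ) / 2) : ℝ) : ℂ) * (𝓕 u : L2 d) ((2 * Real.pi)⁻¹ • ξ)

/-- `F_{t,x}[u](τ, ξ) = (2π)^{-(d+1)/2} ∫∫ u(t, x) e^{-i x · ξ - i t τ} dx dt` for a continuous
compactly supported curve `u : ℝ → L²(ℝ^d)`; the time integral is a Bochner integral in `L²`. -/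
def spaceTimeFourier {d : ℕ} (u : ℝ → L2 d) (τ : ℝ) (ξ : Space d) : ℂ :=
  (((2 * Real.pi) ^ (-(1 : ℝ) / 2) : ℝ) : ℂ) *
    spaceFourier (∫ t : ℝ, Complex.exp (-(Complex.I * t * τ)) • u t) ξ

/-- The norm of `X_{N,σ}`: `∑_j 2^{j/2} ‖η_j(τ + σ|ξ|²) F(τ, ξ)‖_{L²_{τ,ξ}}`. -/
def xNorm (η : ℝ → ℝ) {d : ℕ} (σ : ℝ) (F : ℝ → Space d → ℂ) : ℝ≥0∞ :=
  ∑' j : ℕ, ENNReal.ofReal ((2 : ℝ) ^ ((j : ℝ) / 2)) *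
    (∫⁻ τ : ℝ, ∫⁻ ξ : Space d,
      ‖((etaJ η j (τ + σ * ‖ξ‖ ^ 2) : ℝ) : ℂ) * F τ ξ‖ₑ ^ 2) ^ (1 / 2 : ℝ)

/-- The norm of `F^a_{N,σ,T}`, `N = 2 ^ k`: the supremum over `t_N` of the `X_{N,σ}` norm of
`F_{t,x}[η_0(N^a T⁻¹ (t - t_N)) u]`. -/
def shortNorm (η : ℝ → ℝ) {d : ℕ} (a σ T : ℝ) (k : ℕ) (u : ℝ → L2 d) : ℝ≥0∞ :=
  ⨆ tN : ℝ, xNorm η σ (spaceTimeFourier fun t =>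
    ((etaJ η 0 (((2 : ℝ) ^ k) ^ a * T⁻¹ * (t - tN)) : ℝ) : ℂ) • u t)

/-- The space `F^a_{N,σ,T}`, `N = 2 ^ k`. -/
structure MemShort (η : ℝ → ℝ) {d : ℕ} (a σ T : ℝ) (k : ℕ) (u : ℝ → L2 d) : Prop where
  continuous : Continuous u
  eq_zero : ∀ t, t ∉ Icc (-4 : ℝ) 4 → u t = 0
  support : ∀ τ, ∀ᵐ ξ : Space d, ξ ∉ freqRegion d k → spaceTimeFourier u τ ξ = 0
  finite : shortNorm η a σ T k u < ⊤

/-- The norm of `F^a_{N,σ}(T)`, `N = 2 ^ k`: the infimum over the extensions in `F^a_{N,σ,T}` of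
the restriction of `v` to `[0, T]` (`⊤` if there is none). -/
def localNorm (η : ℝ → ℝ) {d : ℕ} (a σ T : ℝ) (k : ℕ) (v : ℝ → 𝓢'(Space d, ℂ)) : ℝ≥0∞ :=
  ⨅ (u : ℝ → L2 d) (_ : MemShort η a σ T k u)
    (_ : ∀ t ∈ Icc 0 T, ((u t : L2 d) : 𝓢'(Space d, ℂ)) = v t), shortNorm η a σ T k u

/-- The Fourier multiplier with symbol `m(ξ)`, where `ξ` is dual to `x` through `e^{-i x · ξ}`;
the library's multiplier uses the frequency variable `ξ / (2π)`. -/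
def multiplier {d : ℕ} (m : Space d → ℂ) : 𝓢'(Space d, ℂ) →L[ℂ] 𝓢'(Space d, ℂ) :=
  fourierMultiplierCLM ℂ fun x => m ((2 * Real.pi) • x)

/-- The Littlewood-Paley projection `P_N`, `N = 2 ^ k`. -/
def lpProj (η : ℝ → ℝ) {d : ℕ} (k : ℕ) : 𝓢'(Space d, ℂ) →L[ℂ] 𝓢'(Space d, ℂ) :=
  multiplier fun ξ => ((psi η k ξ : ℝ) : ℂ)

/-- The operator `(1 - Δ)^{s/2}`. -/
def bessel {d : ℕ} (s : ℝ) : 𝓢'(Space d, ℂ) →L[ℂ] 𝓢'(Space d, ℂ) :=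
  multiplier fun ξ => (((1 + ‖ξ‖ ^ 2) ^ (s / 2) : ℝ) : ℂ)

/-- The Schrödinger propagator `e^{i t σ Δ}`. -/
def propagator {d : ℕ} (σ t : ℝ) : 𝓢'(Space d, ℂ) →L[ℂ] 𝓢'(Space d, ℂ) :=
  multiplier fun ξ => Complex.exp (-(Complex.I * t * σ * ((‖ξ‖ ^ 2 : ℝ) : ℂ)))

/-- The `H^s` norm, `⊤` off `H^s`. -/
def sobolevNorm {d : ℕ} (s : ℝ) (u : 𝓢'(Space d, ℂ)) : ℝ≥0∞ :=
  ⨅ (h : L2 d) (_ : bessel s u = (h : 𝓢'(Space d, ℂ))), ‖h‖ₑ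

/-- `u ∈ C([0, T]; H^s)`. -/
def MemCH {d : ℕ} (s T : ℝ) (u : ℝ → 𝓢'(Space d, ℂ)) : Prop :=
  ∃ h : ℝ → L2 d, ContinuousOn h (Icc 0 T) ∧
    ∀ t ∈ Icc 0 T, bessel s (u t) = ((h t : L2 d) : 𝓢'(Space d, ℂ))

/-- The norm of `F^{s,a}_σ(T)`: the `ℓ²` norm over `N = 2 ^ k` of `N^s ‖P_N u‖_{F^a_{N,σ}(T)}`. -/
def fNorm (η : ℝ → ℝ) {d : ℕ} (s a σ T : ℝ) (u : ℝ → 𝓢'(Space d, ℂ)) : ℝ≥0∞ :=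
  (∑' k : ℕ, (ENNReal.ofReal (((2 : ℝ) ^ k) ^ s) *
    localNorm η a σ T k (fun t => lpProj η k (u t))) ^ 2) ^ (1 / 2 : ℝ)

/-- The space `F^{s,a}_σ(T)`. -/
def MemF (η : ℝ → ℝ) {d : ℕ} (s a σ T : ℝ) (u : ℝ → 𝓢'(Space d, ℂ)) : Prop :=
  MemCH s T u ∧ fNorm η s a σ T u < ⊤

/-- A curve of `L²` functions, seen as a curve of tempered distributions. -/
def toDist {d : ℕ} (f : ℝ → L2 d) (t : ℝ) : 𝓢'(Space d, ℂ) := ((f t : L2 d) : 𝓢'(Space d, ℂ))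

/-- The product `f ḡ` of two `L²` functions, an element of `L¹`, as a tempered distribution. -/
def mulConj {d : ℕ} (f g : L2 d) : 𝓢'(Space d, ℂ) :=
  ((f • star g : Lp ℂ 1 (volume : Measure (Space d))) : 𝓢'(Space d, ℂ))

/-- `D = ∫_0^t e^{i (t - t') γ Δ} ∂_{x_j} (f ḡ)(t') dt'` in the sense of tempered distributions. -/
def IsDuhamel {d : ℕ} (γ : ℝ) (j : Fin d) (f g : ℝ → L2 d) (t : ℝ)
    (D : 𝓢'(Space d, ℂ)) : Prop :=
  ∀ φ : 𝓢(Space d, ℂ),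
    IntervalIntegrable (fun t' => propagator γ (t - t')
      (∂_{EuclideanSpace.single j (1 : ℝ)} (mulConj (f t') (g t'))) φ) volume 0 t ∧
    D φ = ∫ t' in (0 : ℝ)..t, propagator γ (t - t')
      (∂_{EuclideanSpace.single j (1 : ℝ)} (mulConj (f t') (g t'))) φ

/-- At each time in `[0, T]`, the spatial Fourier transform of `f` is supported in `I_N`,
`N = 2 ^ k`. -/
def FreqSupported {d : ℕ} (T : ℝ) (k : ℕ) (f : ℝ → L2 d) : Prop :=
  ∀ t ∈ Icc 0 T, ∀ᵐ ξ : Space d, ξ ∉ freqRegion d k → spaceFourier (f t) ξ = 0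

end ShortTime

end

/-! Write `X = N = 2 ^ k`. A wave of `f` at frequency `w + z` times a conjugated wave of `g` at
frequency `z` gives an output at frequency `w`. For free solutions `f` and `g`, measured against the
flow `e^{itγΔ}`, this output carries the phase `t ((β - γ)|z|² - 2γ w·z)`: because `α = γ`, the
terms `|w|²` cancel (`resonance_eq`). When `w` is close to `X e_j`, the product `w·z` is large only
through `z_j`. So let the Fourier data of `f` be the indicator of a fixed-size ball `A` around `X
e_j`, and that of `g` the indicator of the slab `B = {|z| < r, |z_j| ≤ r / X}`, up to the factor
`2π` of the library's frequency variable. If `r` is small, independently of `X`, the phase stays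
below `1` in absolute value on `[0, T]` (`abs_resonance_phase_le`). Nothing cancels in the time
integral and the derivative contributes a full factor `X`: on the concentric ball of half the
radius, the Fourier transform of the Duhamel term at time `T` is at least a multiple of `X T |B|`
(`norm_duhamelHat_ge`).

For the upper bounds, the `X_{N,σ}` norm of a time-localized free solution factors into a
one-dimensional modulation sum of the cutoff and the `L²` norm of the data (`xNorm_free`). For
cutoffs at scale `1 / M` with `M = N^a / T` the sum is `O(√M)`
(`IsBump.exists_modulation_sum_bound`), so the norms of `f` and `g` are at most multiples of `X^{s +
a/2}` and `|B|^{1/2}`, with constants depending on `T`. The Duhamel term has `H^s` norm at least a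
multiple of `X^{s+1} |B|`. As `|B| ≥ v / X` (`exists_slab_volume_ge`), the quotient is at least a
multiple of `X^{(1-a)/2}`, which is unbounded since `a < 1`.

All objects are described by bounded, compactly supported functions on the Fourier side (`synth`),
where products become correlations and multipliers become pointwise multiplication. -/

noncomputable section

namespace ShortTime

/-! ### `L²` functions with bounded, compactly supported Fourier data -/

/-- Bounded Borel functions with bounded support. -/
structure IsBddSupp {E : Type*} [NormedAddCommGroup E] [MeasurableSpace E] (F : E → ℂ) : Prop where
  measurable : Measurable F
  bound : ∃ R : ℝ, 0 ≤ R ∧ (∀ y, ‖F y‖ ≤ R) ∧ ∀ y, R < ‖y‖ → F y = 0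

namespace IsBddSupp

variable {E : Type*} [NormedAddCommGroup E] [MeasurableSpace E]

theorem memLp [BorelSpace E] [ProperSpace E] {F : E → ℂ} (hF : IsBddSupp F) (μ : Measure E)
    [IsFiniteMeasureOnCompacts μ] (p : ℝ≥0∞) : MemLp F p μ := by
  obtain ⟨R, hR0, hR, hs⟩ := hF.bound
  have h1 : F = (Metric.closedBall 0 R).indicator F := by
    ext y
    by_cases hy : y ∈ Metric.closedBall (0 : E) R
    · rw [indicator_of_mem hy]
    · rw [indicator_of_notMem hy, hs y (by simpa using hy)]
  rw [h1, memLp_indicator_iff_restrict Metric.isClosed_closedBall.measurableSet]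
  have : IsFiniteMeasure (μ.restrict (Metric.closedBall 0 R)) :=
    ⟨by simpa using (isCompact_closedBall (0 : E) R).measure_lt_top⟩
  exact MemLp.of_bound hF.measurable.aestronglyMeasurable R (ae_of_all _ hR)

theorem integrable [BorelSpace E] [ProperSpace E] {F : E → ℂ} (hF : IsBddSupp F) (μ : Measure E)
    [IsFiniteMeasureOnCompacts μ] : Integrable F μ :=
  memLp_one_iff_integrable.1 (hF.memLp μ 1)

theorem zero : IsBddSupp (fun _ : E => (0 : ℂ)) :=
  ⟨measurable_const, 0, le_rfl, by simp, by simp⟩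

theorem mul_continuous [BorelSpace E] [ProperSpace E] {F m : E → ℂ} (hF : IsBddSupp F)
    (hm : Continuous m) : IsBddSupp fun y => m y * F y := by
  obtain ⟨R, hR0, hR, hs⟩ := hF.bound
  obtain ⟨K, hK⟩ := (isCompact_closedBall (0 : E) R).exists_bound_of_continuousOn hm.continuousOn
  refine ⟨hm.measurable.mul hF.measurable, max R (K * R), le_max_of_le_left hR0,
    fun y => ?_, fun y hy => ?_⟩
  · by_cases hy : ‖y‖ ≤ R
    · rw [norm_mul]
      refine le_trans ?_ (le_max_right _ _)
      have := hK y (by simpa using hy)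
      exact mul_le_mul this (hR y) (norm_nonneg _) ((norm_nonneg _).trans this)
    · rw [hs y (not_le.1 hy)]
      simp [hR0]
  · rw [hs y ((le_max_left _ _).trans_lt hy), mul_zero]

theorem sub {F G : E → ℂ} (hF : IsBddSupp F) (hG : IsBddSupp G) :
    IsBddSupp fun y => F y - G y := by
  obtain ⟨R, hR0, hR, hs⟩ := hF.bound
  obtain ⟨S, hS0, hS, ht⟩ := hG.bound
  refine ⟨hF.measurable.sub hG.measurable, R + S, by positivity, fun y =>
    (norm_sub_le _ _).trans (add_le_add (hR y) (hS y)), fun y hy => ?_⟩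
  rw [hs y (by linarith), ht y (by linarith), sub_zero]

end IsBddSupp

variable {d : ℕ}

/-- The `L²` function whose Fourier transform (with the library's normalization) is `F`. -/
def synth (F : Space d → ℂ) : L2 d := by
  classical exact if h : MemLp F 2 volume then 𝓕⁻ (h.toLp F) else 0

theorem synth_eq {F : Space d → ℂ} (hF : IsBddSupp F) :
    synth F = 𝓕⁻ ((hF.memLp volume 2).toLp F) := by
  rw [synth, dif_pos (hF.memLp volume 2)]

theorem synth_zero : synth (fun _ : Space d => (0 : ℂ)) = 0 := by
  rw [synth_eq IsBddSupp.zero]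
  have : (IsBddSupp.zero.memLp volume 2).toLp (fun _ : Space d => (0 : ℂ)) = 0 :=
    MemLp.toLp_zero _
  rw [this]
  exact map_zero (Lp.fourierTransformₗᵢ (Space d) ℂ).symm

theorem synth_sub {F G : Space d → ℂ} (hF : IsBddSupp F) (hG : IsBddSupp G) :
    synth F - synth G = synth fun y => F y - G y := by
  rw [synth_eq hF, synth_eq hG, synth_eq (hF.sub hG)]
  have h := MemLp.toLp_sub (hF.memLp volume 2) (hG.memLp volume 2)
  have h' : ((hF.sub hG).memLp volume 2).toLp (fun y => F y - G y) =
    (hF.memLp volume 2).toLp F - (hG.memLp volume 2).toLp G := h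
  rw [h']
  exact (map_sub (Lp.fourierTransformₗᵢ (Space d) ℂ).symm _ _).symm

theorem fourier_synth {F : Space d → ℂ} (hF : IsBddSupp F) :
    (𝓕 (synth F) : L2 d) =ᵐ[volume] F := by
  rw [synth_eq hF, FourierTransform.fourier_fourierInv_eq]
  exact MemLp.coeFn_toLp _

theorem enorm_synth {F : Space d → ℂ} (hF : IsBddSupp F) :
    ‖synth F‖ₑ = (∫⁻ y, ‖F y‖ₑ ^ 2) ^ (1 / 2 : ℝ) := by
  have h1 : ‖synth F‖ₑ = ‖(hF.memLp volume 2).toLp F‖ₑ := by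
    rw [synth_eq hF]
    have := (Lp.fourierTransformₗᵢ (Space d) ℂ).symm.norm_map ((hF.memLp volume 2).toLp F)
    rw [← ofReal_norm, ← ofReal_norm]
    exact congrArg ENNReal.ofReal this
  rw [h1, Lp.enorm_toLp, eLpNorm_eq_lintegral_rpow_enorm_toReal (by simp) (by simp)]
  simp

theorem spaceFourier_synth {F : Space d → ℂ} (hF : IsBddSupp F) :
    ∀ᵐ ξ, spaceFourier (synth F) ξ =
      (((2 * Real.pi) ^ (-(d : ℝ) / 2) : ℝ) : ℂ) * F ((2 * Real.pi)⁻¹ • ξ) := by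
  have hq : Measure.QuasiMeasurePreserving (fun ξ : Space d => (2 * Real.pi)⁻¹ • ξ) := by
    refine ⟨by fun_prop, ?_⟩
    rw [Measure.map_addHaar_smul _ (by positivity)]
    exact Measure.smul_absolutelyContinuous
  filter_upwards [hq.ae (fourier_synth hF)] with ξ hξ
  rw [spaceFourier, hξ]

/-- Tempered distributions determine `L²` functions. -/
theorem toTemperedDistribution_injective {u v : L2 d}
    (h : (u : 𝓢'(Space d, ℂ)) = (v : 𝓢'(Space d, ℂ))) : u = v := by
  have := Lp.ker_toTemperedDistributionCLM_eq_bot (F := ℂ) (μ := (volume : Measure (Space d)))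
    (p := 2)
  exact LinearMap.ker_eq_bot.1 this h

/-- Moves the Fourier transform onto the test function, so that identities between distributions
reduce to identities between integrals over frequency space. -/
theorem synth_dist_apply {F : Space d → ℂ} (hF : IsBddSupp F) (φ : 𝓢(Space d, ℂ)) :
    ((synth F : L2 d) : 𝓢'(Space d, ℂ)) φ = ∫ y, F y * (𝓕⁻ φ : 𝓢(Space d, ℂ)) y := by
  rw [synth_eq hF, ← Lp.fourierInv_toTemperedDistribution_eq,
    TemperedDistribution.fourierInv_apply, Lp.toTemperedDistribution_apply]
  refine integral_congr_ae ?_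
  filter_upwards [(hF.memLp volume 2).coeFn_toLp] with y hy
  rw [hy, smul_eq_mul, mul_comm]

/-- Fourier multipliers act on `synth F` by multiplication. -/
theorem multiplier_synth {F m : Space d → ℂ} (hF : IsBddSupp F)
    (hm : (fun x => m ((2 * Real.pi) • x)).HasTemperateGrowth) :
    multiplier m ((synth F : L2 d) : 𝓢'(Space d, ℂ)) =
      ((synth fun y => m ((2 * Real.pi) • y) * F y : L2 d) : 𝓢'(Space d, ℂ)) := by
  ext φ
  rw [multiplier, fourierMultiplierCLM_apply_apply, synth_dist_apply hF, synth_dist_apply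
    (hF.mul_continuous hm.1.continuous), FourierTransform.fourierInv_fourier_eq]
  refine integral_congr_ae (ae_of_all _ fun y => ?_)
  simp only [SchwartzMap.smulLeftCLM_apply_apply hm, smul_eq_mul]
  ring

/-- For bounded `F` with bounded support, `synth F` is the inverse Fourier integral of `F`. -/
theorem coeFn_synth {F : Space d → ℂ} (hF : IsBddSupp F) :
    (synth F : L2 d) =ᵐ[volume] (𝓕⁻ F : Space d → ℂ) := by
  have hFi := hF.integrable volume
  have hc : Continuous (𝓕⁻ F : Space d → ℂ) := by
    rw [Real.fourierInv_eq_fourier_comp_neg]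
    exact VectorFourier.fourierIntegral_continuous Real.continuous_fourierChar
      (by exact continuous_inner) hFi.comp_neg
  have hloc : LocallyIntegrable (synth F : L2 d) volume :=
    (Lp.memLp (synth F)).locallyIntegrable (by norm_num)
  -- Both sides are locally integrable, so it suffices to test against smooth compactly supported
  -- `g`; such `g` is Schwartz, and the self-adjointness of the Fourier integral moves the transform
  -- from `g` to `F`.
  refine ae_eq_of_integral_contDiff_smul_eq hloc hc.locallyIntegrable fun g hg hgc => ?_
  have hg₁ : HasCompactSupport (Complex.ofRealCLM ∘ g) := hgc.comp_left rfl
  have hg₂ : ContDiff ℝ ∞ (Complex.ofRealCLM ∘ g) := by fun_prop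
  have h1 := synth_dist_apply hF (hg₁.toSchwartzMap hg₂)
  rw [Lp.toTemperedDistribution_apply] at h1
  have h2 : ∀ x, (hg₁.toSchwartzMap hg₂) x = (g x : ℂ) := fun x => by simp
  simp only [h2, smul_eq_mul] at h1
  simp only [Complex.real_smul]
  rw [h1]
  have hco : ((𝓕⁻ (hg₁.toSchwartzMap hg₂) : 𝓢(Space d, ℂ)) : Space d → ℂ) =
      𝓕⁻ (fun x => (g x : ℂ)) := by
    rw [SchwartzMap.fourierInv_coe]
    exact congrArg _ (funext h2)
  have hgi : Integrable (fun x => (g x : ℂ)) volume :=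
    (hg.continuous.integrable_of_hasCompactSupport hgc).ofReal
  have hflip := VectorFourier.integral_fourierIntegral_smul_eq_flip (L := -innerₗ (Space d))
    (μ := volume) (ν := volume) Real.continuous_fourierChar
    (by exact continuous_inner.neg) hgi hFi
  have e1 : VectorFourier.fourierIntegral Real.fourierChar volume (-innerₗ (Space d))
      (fun x => (g x : ℂ)) = 𝓕⁻ (fun x => (g x : ℂ)) := rfl
  have e2 : VectorFourier.fourierIntegral Real.fourierChar volume (-innerₗ (Space d)).flip F =
      𝓕⁻ F := by
    have : (-innerₗ (Space d)).flip = -innerₗ (Space d) := by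
      ext x y
      simp [real_inner_comm]
    rw [this]
    rfl
  rw [e1, e2] at hflip
  simp only [smul_eq_mul] at hflip
  rw [hco, ← hflip]
  exact integral_congr_ae (ae_of_all _ fun x => mul_comm _ _)

/-! ### Symbols of temperate growth -/

theorem hasTemperateGrowth_cexp_I :
    (fun θ : ℝ => Complex.exp (Complex.I * θ)).HasTemperateGrowth := by
  have hd : ∀ n : ℕ, iteratedDeriv n (fun θ : ℝ => Complex.exp (Complex.I * θ)) =
      fun θ : ℝ => Complex.I ^ n * Complex.exp (Complex.I * θ) := by
    intro n
    induction n with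
    | zero => simp
    | succ n ih =>
      rw [iteratedDeriv_succ, ih]
      ext θ
      have h1 : HasDerivAt (fun θ : ℝ => Complex.exp (Complex.I * θ))
          (Complex.exp (Complex.I * θ) * (Complex.I * 1)) θ :=
        ((Complex.ofRealCLM.hasDerivAt (x := θ)).const_mul Complex.I).cexp
      rw [(h1.const_mul _).deriv]
      ring
  refine ⟨Complex.contDiff_exp.comp (contDiff_const.mul Complex.ofRealCLM.contDiff),
    fun n => ⟨0, 1, fun θ => ?_⟩⟩
  rw [norm_iteratedFDeriv_eq_norm_iteratedDeriv, hd]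
  simp [mul_comm Complex.I, Complex.norm_exp_ofReal_mul_I]

theorem hasTemperateGrowth_scaled_norm_sq :
    (fun x : Space d => ‖(2 * Real.pi) • x‖ ^ 2).HasTemperateGrowth := by
  have : (fun x : Space d => ‖(2 * Real.pi) • x‖ ^ 2) =
      fun x => (2 * Real.pi) ^ 2 * ‖x‖ ^ 2 := by
    ext x
    rw [norm_smul, mul_pow, Real.norm_eq_abs, sq_abs]
  rw [this]
  exact (Function.HasTemperateGrowth.const _).mul
    (Function.hasTemperateGrowth_norm_sq (Space d))

theorem hasTemperateGrowth_propagator (c : ℝ) :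
    (fun x : Space d =>
      Complex.exp (Complex.I * ((c * ‖(2 * Real.pi) • x‖ ^ 2 : ℝ) : ℂ))).HasTemperateGrowth :=
  hasTemperateGrowth_cexp_I.comp
    ((Function.HasTemperateGrowth.const c).mul hasTemperateGrowth_scaled_norm_sq)

theorem hasTemperateGrowth_bessel (s : ℝ) :
    (fun x : Space d =>
      (((1 + ‖(2 * Real.pi) • x‖ ^ 2) ^ (s / 2) : ℝ) : ℂ)).HasTemperateGrowth := by
  have h1 : (fun x : Space d => (2 * Real.pi) • x).HasTemperateGrowth :=
    ((2 * Real.pi) • ContinuousLinearMap.id ℝ (Space d)).hasTemperateGrowth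
  exact Function.Complex.hasTemperateGrowth_ofReal.comp
    ((Function.hasTemperateGrowth_one_add_norm_sq_rpow (Space d) (s / 2)).comp h1)

/-! ### Bump functions and Littlewood-Paley symbols -/

namespace IsBump

variable {η : ℝ → ℝ}

theorem nonneg (hη : IsBump η) (x : ℝ) : 0 ≤ η x :=
  le_trans (indicator_nonneg (fun _ _ => zero_le_one) x) (hη.lower x)

theorem le_one (hη : IsBump η) (x : ℝ) : η x ≤ 1 :=
  (hη.upper x).trans (indicator_le_self' (fun _ _ => zero_le_one) x)

theorem eq_one (hη : IsBump η) {x : ℝ} (hx : |x| ≤ 4 / 3) : η x = 1 := by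
  refine le_antisymm (hη.le_one x) ?_
  have := hη.lower x
  rwa [indicator_of_mem (mem_Icc.2 (abs_le.1 hx))] at this

theorem eq_zero (hη : IsBump η) {x : ℝ} (hx : 5 / 3 < |x|) : η x = 0 := by
  refine le_antisymm ?_ (hη.nonneg x)
  have := hη.upper x
  rwa [indicator_of_notMem fun h => (not_le.2 hx) (abs_le.2 (mem_Icc.1 h))] at this

theorem hasCompactSupport (hη : IsBump η) : HasCompactSupport η :=
  HasCompactSupport.of_support_subset_isCompact (isCompact_Icc (a := -(5 / 3 : ℝ)) (b := 5 / 3))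
    fun x hx => by
      by_contra h
      exact hx (hη.eq_zero (lt_of_not_ge fun h' => h (abs_le.1 h')))

/-- The norm is not smooth at the origin, but `η` is constant near `0`, so the composition is smooth
there too. -/
theorem hasTemperateGrowth_norm (hη : IsBump η) {c : ℝ} (hc : 0 < c) :
    (fun x : Space d => ((η (c * ‖x‖) : ℝ) : ℂ)).HasTemperateGrowth := by
  refine Function.Complex.hasTemperateGrowth_ofReal.comp (HasCompactSupport.hasTemperateGrowth ?_ ?_)
  · refine HasCompactSupport.of_support_subset_isCompact
      (isCompact_closedBall (0 : Space d) (5 / 3 / c)) fun x hx => ?_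
    by_contra h
    refine hx (hη.eq_zero ?_)
    rw [mem_closedBall_zero_iff, not_le, div_lt_iff₀ hc] at h
    rw [abs_of_nonneg (by positivity)]
    linarith
  · rw [contDiff_iff_contDiffAt]
    intro x
    by_cases hx : x = 0
    · subst hx
      refine (contDiffAt_const (c := (1 : ℝ))).congr_of_eventuallyEq ?_
      filter_upwards [Metric.ball_mem_nhds (0 : Space d) (show 0 < 4 / 3 / c by positivity)]
        with y hy
      rw [mem_ball_zero_iff, lt_div_iff₀ hc] at hy
      refine hη.eq_one ?_
      rw [abs_of_nonneg (by positivity)]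
      linarith
    · exact hη.smooth.contDiffAt.comp x (contDiffAt_const.mul (contDiffAt_norm ℝ hx))

theorem hasTemperateGrowth_psi (hη : IsBump η) (k : ℕ) :
    (fun x : Space d => ((psi η k ((2 * Real.pi) • x) : ℝ) : ℂ)).HasTemperateGrowth := by
  have hpi := Real.pi_pos
  have hn : ∀ x : Space d, ‖(2 * Real.pi) • x‖ = 2 * Real.pi * ‖x‖ := fun x => by
    rw [norm_smul, Real.norm_of_nonneg (by positivity)]
  unfold psi
  split_ifs
  · simp only [hn]
    exact hη.hasTemperateGrowth_norm (by positivity)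
  · have h1 := hη.hasTemperateGrowth_norm (d := d) (c := 2 * Real.pi / 2 ^ k) (by positivity)
    have h2 := hη.hasTemperateGrowth_norm (d := d) (c := 2 * (2 * Real.pi) / 2 ^ k) (by positivity)
    convert h1.sub h2 using 2 with x
    simp only [Pi.sub_apply, Complex.ofReal_sub, hn]
    ring_nf

/-- The constants mark the plateau of the symbol: `η(|ξ| / N) = 1` needs `|ξ| ≤ 4N / 3`, and `η(2|ξ|
/ N) = 0` needs `|ξ| > 5N / 6`, half of `5 / 3`. -/
theorem psi_eq_one (hη : IsBump η) {k : ℕ} {ξ : Space d} (h1 : k = 0 ∨ 5 / 6 * 2 ^ k < ‖ξ‖)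
    (h2 : ‖ξ‖ ≤ 4 / 3 * 2 ^ k) : psi η k ξ = 1 := by
  have hp : (0 : ℝ) < 2 ^ k := by positivity
  unfold psi
  split_ifs with hk
  · subst hk
    exact hη.eq_one (by rw [abs_of_nonneg (norm_nonneg _)]; simpa using h2)
  · have h1 := h1.resolve_left hk
    rw [hη.eq_one, hη.eq_zero, sub_zero]
    · rw [abs_of_nonneg (by positivity), lt_div_iff₀ hp]
      linarith
    · rw [abs_of_nonneg (by positivity), div_le_iff₀ hp]
      linarith

theorem psi_eq_zero (hη : IsBump η) {k l : ℕ} (hl : l ≠ k) {ξ : Space d} (h1 : k = 0 ∨ 5 / 6 * 2 ^ k < ‖ξ‖)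
    (h2 : ‖ξ‖ ≤ 4 / 3 * 2 ^ k) : psi η l ξ = 0 := by
  have hp : (0 : ℝ) < 2 ^ k := by positivity
  have hq : (0 : ℝ) < 2 ^ l := by positivity
  rcases lt_or_gt_of_ne hl with h | h
  · have h1 := h1.resolve_left (by omega)
    have h3 : (2 : ℝ) * 2 ^ l ≤ 2 ^ k := by
      rw [← pow_succ']
      exact pow_le_pow_right₀ (by norm_num) h
    have e1 : η (‖ξ‖ / 2 ^ l) = 0 := by
      refine hη.eq_zero ?_
      rw [abs_of_nonneg (by positivity), lt_div_iff₀ hq]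
      linarith
    have e2 : η (2 * ‖ξ‖ / 2 ^ l) = 0 := by
      refine hη.eq_zero ?_
      rw [abs_of_nonneg (by positivity), lt_div_iff₀ hq]
      linarith
    unfold psi
    split_ifs with h0
    · subst h0
      simpa using e1
    · rw [e1, e2, sub_zero]
  · have h3 : (2 : ℝ) * 2 ^ k ≤ 2 ^ l := by
      rw [← pow_succ']
      exact pow_le_pow_right₀ (by norm_num) h
    unfold psi
    rw [if_neg (by omega), hη.eq_one, hη.eq_one, sub_self]
    · rw [abs_of_nonneg (by positivity), div_le_iff₀ hq]
      linarith
    · rw [abs_of_nonneg (by positivity), div_le_iff₀ hq]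
      linarith

end IsBump

/-! ### Fourier transforms of time cutoffs and their modulation sums -/

variable {η : ℝ → ℝ}

/-- The Fourier integral `∫ ρ(t) e^{-itλ} dt`. -/
def timeFourier (ρ : ℝ → ℝ) (l : ℝ) : ℂ :=
  ∫ t : ℝ, Complex.exp (-(Complex.I * t * l)) * (ρ t : ℂ)

theorem timeFourier_eq (ρ : ℝ → ℝ) (l : ℝ) :
    timeFourier ρ l = 𝓕 (fun t => (ρ t : ℂ)) (l / (2 * Real.pi)) := by
  have hpi := Real.pi_ne_zero
  rw [Real.fourier_real_eq_integral_exp_smul, timeFourier]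
  refine integral_congr_ae (ae_of_all _ fun t => ?_)
  simp only [smul_eq_mul]
  congr 2
  push_cast
  field_simp

theorem norm_integral_le_of_support {h : ℝ → ℂ} {c r B : ℝ} (hr : 0 ≤ r)
    (hB : ∀ t, ‖h t‖ ≤ B) (hs : ∀ t, t ∉ Icc (c - r) (c + r) → h t = 0) :
    ‖∫ t, h t‖ ≤ B * (2 * r) := by
  rw [← setIntegral_eq_integral_of_forall_compl_eq_zero (s := Icc (c - r) (c + r)) hs]
  refine (norm_setIntegral_le_of_norm_le_const (by simp) fun t _ => hB t).trans_eq ?_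
  rw [Real.volume_real_Icc_of_le (by linarith)]
  ring

theorem IsBump.exists_iteratedDeriv_bound (hη : IsBump η) :
    ∃ B : ℝ, 1 ≤ B ∧ ∀ i ≤ 2, ∀ t, ‖iteratedFDeriv ℝ i (fun t => (η t : ℂ)) t‖ ≤ B := by
  have hs : ContDiff ℝ ∞ (fun t => (η t : ℂ)) := Complex.ofRealCLM.contDiff.comp hη.smooth
  have hc : HasCompactSupport (fun t => (η t : ℂ)) :=
    hη.hasCompactSupport.comp_left Complex.ofReal_zero
  have h : ∀ i, ∃ B, ∀ t, ‖iteratedFDeriv ℝ i (fun t => (η t : ℂ)) t‖ ≤ B := fun i =>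
    (hs.continuous_iteratedFDeriv (mod_cast le_top)).bounded_above_of_compact_support
      (hc.iteratedFDeriv i)
  choose B hB using h
  refine ⟨max 1 (max (B 0) (max (B 1) (B 2))), le_max_left _ _, fun i hi t => ?_⟩
  refine (hB i t).trans ?_
  interval_cases i <;> simp

/-- The Fourier transforms of the cutoffs `η(M(t - t₀)) η(t)`. -/
theorem IsBump.exists_timeFourier_bound (hη : IsBump η) :
    ∃ K : ℝ, 1 ≤ K ∧ ∀ M : ℝ, 1 ≤ M → ∀ t₀ l : ℝ,
      M * ‖timeFourier (fun t => η (M * (t - t₀)) * η t) l‖ ≤ K ∧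
      l ^ 2 * ‖timeFourier (fun t => η (M * (t - t₀)) * η t) l‖ ≤ K * M := by
  obtain ⟨B, hB1, hB⟩ := hη.exists_iteratedDeriv_bound
  -- `10 / 3` is `M` times the length of an interval containing the support of the cutoff; `4 = 1 +
  -- 2 + 1` comes from the Leibniz rule for the second derivative.
  refine ⟨4 * B ^ 2 * (10 / 3), by nlinarith, fun M hM t₀ l => ?_⟩
  have hM0 : 0 < M := by linarith
  have hpi := Real.pi_pos
  set ρ : ℝ → ℝ := fun t => η (M * (t - t₀)) * η t with hρ
  have hsupp : ∀ t, t ∉ Icc (t₀ - 5 / 3 / M) (t₀ + 5 / 3 / M) → (ρ t : ℂ) = 0 := fun t ht => by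
    have : η (M * (t - t₀)) = 0 := by
      refine hη.eq_zero ?_
      rw [abs_mul, abs_of_pos hM0, mul_comm, ← div_lt_iff₀ hM0]
      by_contra! h
      rw [abs_le] at h
      exact ht ⟨by linarith, by linarith⟩
    simp [hρ, this]
  have hs : ContDiff ℝ ∞ (fun t => (η t : ℂ)) := Complex.ofRealCLM.contDiff.comp hη.smooth
  have hs1 : ContDiff ℝ ∞ (fun t => (η (M * (t - t₀)) : ℂ)) := hs.comp (by fun_prop)
  have hρs : ContDiff ℝ ∞ (fun t => (ρ t : ℂ)) := by
    simp only [hρ, Complex.ofReal_mul]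
    exact hs1.mul hs
  have hρc : HasCompactSupport (fun t => (ρ t : ℂ)) :=
    HasCompactSupport.intro isCompact_Icc hsupp
  have hint : ∀ n : ℕ, (n : ℕ∞) ≤ 2 → Integrable (iteratedDeriv n fun t => (ρ t : ℂ)) := by
    intro n _
    refine Continuous.integrable_of_hasCompactSupport
      (hρs.continuous_iteratedDeriv n (mod_cast le_top)) ?_
    have := hρc.iteratedFDeriv (𝕜 := ℝ) n
    rw [iteratedDeriv_eq_equiv_comp]
    exact this.comp_left (map_zero _)
  have hF := congrFun (Real.fourier_iteratedDeriv (n := 2) (N := 2)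
    (contDiff_infty.1 hρs 2) hint le_rfl) (l / (2 * Real.pi))
  -- Differentiating `i` times produces `M ^ i`, which is at most `M ^ 2` because `M ≥ 1`.
  have hb1 : ∀ i ≤ 2, ∀ t, ‖iteratedFDeriv ℝ i (fun t => (η (M * (t - t₀)) : ℂ)) t‖ ≤
      M ^ 2 * B := by
    intro i hi t
    have h1 : iteratedDeriv i (fun t => (η (M * (t - t₀)) : ℂ)) t =
        (M ^ i : ℝ) • iteratedDeriv i (fun t => (η t : ℂ)) (M * (t - t₀)) := by
      have e1 := congrFun (iteratedDeriv_comp_sub_const i (fun t => (η (M * t) : ℂ)) t₀) t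
      have e2 := congrFun (iteratedDeriv_comp_const_smul (n := i)
        (f := fun t : ℝ => (η t : ℂ)) (contDiff_infty.1 hs i) M) (t - t₀)
      rw [e1, e2]
    rw [norm_iteratedFDeriv_eq_norm_iteratedDeriv, h1, norm_smul,
      ← norm_iteratedFDeriv_eq_norm_iteratedDeriv, Real.norm_of_nonneg (by positivity)]
    exact mul_le_mul (pow_le_pow_right₀ hM hi) (hB i hi _) (norm_nonneg _) (by positivity)
  have hb2 : ∀ t, ‖iteratedDeriv 2 (fun t => (ρ t : ℂ)) t‖ ≤ 4 * B ^ 2 * M ^ 2 := by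
    intro t
    have h := norm_iteratedFDeriv_mul_le (n := 2) (contDiff_infty.1 hs1 2) (contDiff_infty.1 hs 2) t le_rfl
    have h' : (fun t => (ρ t : ℂ)) = fun t => (η (M * (t - t₀)) : ℂ) * (η t : ℂ) := by
      ext t; simp [hρ]
    rw [← norm_iteratedFDeriv_eq_norm_iteratedDeriv, h']
    refine h.trans ?_
    have hc : ∀ i ∈ Finset.range 3, ((2 : ℕ).choose i : ℝ) *
        ‖iteratedFDeriv ℝ i (fun t => (η (M * (t - t₀)) : ℂ)) t‖ *
        ‖iteratedFDeriv ℝ (2 - i) (fun t => (η t : ℂ)) t‖ ≤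
        ((2 : ℕ).choose i : ℝ) * (M ^ 2 * B) * B := fun i hi => by
      have hi' : i ≤ 2 := by simpa [Nat.lt_succ_iff] using hi
      have := hb1 i hi' t
      have := hB (2 - i) (by omega) t
      gcongr
    refine (Finset.sum_le_sum hc).trans_eq ?_
    simp [Finset.sum_range_succ]
    ring
  constructor
  · have h1 : ‖timeFourier ρ l‖ ≤ 1 * (2 * (5 / 3 / M)) := by
      refine norm_integral_le_of_support (c := t₀) (by positivity) (fun t => ?_) fun t ht => ?_
      · have e : -(Complex.I * t * l) = ((-(t * l) : ℝ) : ℂ) * Complex.I := by push_cast; ring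
        rw [norm_mul, e, Complex.norm_exp_ofReal_mul_I, one_mul, Complex.norm_real, hρ, norm_mul,
          Real.norm_of_nonneg (hη.nonneg _), Real.norm_of_nonneg (hη.nonneg _)]
        exact mul_le_one₀ (hη.le_one _) (hη.nonneg _) (hη.le_one _)
      · rw [hsupp t ht, mul_zero]
    calc M * ‖timeFourier ρ l‖ ≤ M * (1 * (2 * (5 / 3 / M))) := by gcongr
      _ = 10 / 3 := by field_simp; norm_num
      _ ≤ _ := by nlinarith
  · have h1 : l ^ 2 * ‖timeFourier ρ l‖ =
        ‖𝓕 (iteratedDeriv 2 fun t => (ρ t : ℂ)) (l / (2 * Real.pi))‖ := by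
      rw [hF, timeFourier_eq, norm_smul, norm_pow]
      congr 1
      have : (2 * (Real.pi : ℂ) * Complex.I * ((l / (2 * Real.pi) : ℝ) : ℂ)) = l * Complex.I := by
        have : (Real.pi : ℂ) ≠ 0 := Complex.ofReal_ne_zero.2 hpi.ne'
        push_cast
        field_simp
      rw [this, norm_mul, Complex.norm_I, mul_one, Complex.norm_real, Real.norm_eq_abs, sq_abs]
    have h2 : ‖𝓕 (iteratedDeriv 2 fun t => (ρ t : ℂ)) (l / (2 * Real.pi))‖ ≤
        4 * B ^ 2 * M ^ 2 * (2 * (5 / 3 / M)) := by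
      rw [Real.fourier_real_eq_integral_exp_smul]
      refine norm_integral_le_of_support (c := t₀) (by positivity) (fun t => ?_) fun t ht => ?_
      · rw [norm_smul, Complex.norm_exp_ofReal_mul_I, one_mul]
        exact hb2 t
      · have hz : iteratedDeriv 2 (fun t => (ρ t : ℂ)) t = 0 := by
          rw [← norm_eq_zero, ← norm_iteratedFDeriv_eq_norm_iteratedDeriv, norm_eq_zero]
          by_contra h
          have h3 := support_iteratedFDeriv_subset (𝕜 := ℝ) 2 h
          refine ht (closure_minimal (fun u hu => ?_) isClosed_Icc h3)
          by_contra hu'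
          exact hu (hsupp u hu')
        rw [hz, smul_zero]
    rw [h1]
    refine h2.trans_eq ?_
    field_simp
    norm_num

theorem IsBump.abs_etaJ_le_one (hη : IsBump η) (j : ℕ) (x : ℝ) : |etaJ η j x| ≤ 1 := by
  unfold etaJ
  split_ifs
  · rw [abs_of_nonneg (hη.nonneg x)]
    exact hη.le_one x
  · have h1 := hη.nonneg (x / 2 ^ j)
    have h2 := hη.nonneg (x / 2 ^ (j - 1))
    have h3 := hη.le_one (x / 2 ^ j)
    have h4 := hη.le_one (x / 2 ^ (j - 1))
    rw [abs_le]
    constructor <;> linarith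

theorem IsBump.etaJ_eq_zero_of_lt (hη : IsBump η) {j : ℕ} {x : ℝ} (hx : 2 ^ (j + 1) < |x|) :
    etaJ η j x = 0 := by
  have key : ∀ i ≤ j, η (x / 2 ^ i) = 0 := fun i hi => by
    refine hη.eq_zero ?_
    have hp : (0 : ℝ) < 2 ^ i := by positivity
    have h1 : (2 : ℝ) ^ i ≤ 2 ^ j := pow_le_pow_right₀ (by norm_num) hi
    rw [abs_div, abs_of_pos hp, lt_div_iff₀ hp]
    rw [pow_succ] at hx
    linarith
  unfold etaJ
  split_ifs with h
  · simpa [h] using key 0 (Nat.zero_le _)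
  · rw [key j le_rfl, key (j - 1) (Nat.sub_le _ _), sub_zero]

theorem IsBump.etaJ_eq_zero_of_abs_lt (hη : IsBump η) {j : ℕ} (hj : j ≠ 0) {x : ℝ}
    (hx : 2 * |x| < 2 ^ j) : etaJ η j x = 0 := by
  obtain ⟨i, rfl⟩ := Nat.exists_eq_succ_of_ne_zero hj
  have hp : (0 : ℝ) < 2 ^ i := by positivity
  rw [Nat.succ_eq_add_one, pow_succ] at hx
  unfold etaJ
  rw [if_neg hj, hη.eq_one, hη.eq_one, sub_self]
  · rw [Nat.succ_eq_add_one, Nat.add_sub_cancel, abs_div, abs_of_pos hp, div_le_iff₀ hp]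
    linarith
  · have hp' : (0 : ℝ) < 2 ^ i * 2 := by positivity
    rw [Nat.succ_eq_add_one, pow_succ, abs_div, abs_of_pos hp', div_le_iff₀ hp']
    linarith

/-- Geometric interpolation: `p² l³ = p^{1/2} (l² p)^{3/2} ≤ (K / M)^{1/2} (K M)^{3/2}`. The squared
inequality avoids fractional powers. -/
theorem sq_mul_cube_le {p l K M : ℝ} (hp : 0 ≤ p) (hl : 0 ≤ l) (hM : 1 ≤ M) (hK : 0 ≤ K)
    (h1 : M * p ≤ K) (h2 : l ^ 2 * p ≤ K * M) : p ^ 2 * l ^ 3 ≤ K ^ 2 * M := by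
  have hM0 : 0 < M := by linarith
  have h3 : (l ^ 2 * p) ^ 3 ≤ (K * M) ^ 3 := pow_le_pow_left₀ (by positivity) h2 3
  have h4 : (M * p) * (l ^ 2 * p) ^ 3 ≤ K * (K * M) ^ 3 :=
    mul_le_mul h1 h3 (by positivity) hK
  have h5 : (p ^ 2 * l ^ 3) ^ 2 ≤ (K ^ 2 * M) ^ 2 := by
    refine le_of_mul_le_mul_left ?_ hM0
    calc M * (p ^ 2 * l ^ 3) ^ 2 = (M * p) * (l ^ 2 * p) ^ 3 := by ring
      _ ≤ K * (K * M) ^ 3 := h4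
      _ = M * (K ^ 2 * M) ^ 2 := by ring
  exact (pow_le_pow_iff_left₀ (by positivity) (by positivity) two_ne_zero).1 h5

/-- The decay `l⁻³` of the squared transform becomes `2^{-3j}`, since `2 ^ j ≤ 2|l|` where `η_j` is
nonzero and `j ≥ 1`; this costs the factor `8 = 2³`. -/
theorem IsBump.norm_sq_etaJ_mul_le (hη : IsBump η) {K M p : ℝ} (hK : 0 ≤ K) (hM : 1 ≤ M)
    (hp : 0 ≤ p) (j : ℕ) (l : ℝ) (h1 : M * p ≤ K) (h2 : l ^ 2 * p ≤ K * M) :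
    (|etaJ η j l| * p) ^ 2 ≤ 8 * K ^ 2 * M * ((2 : ℝ) ^ j)⁻¹ ^ 3 := by
  have hM0 : 0 < M := by linarith
  by_cases hz : etaJ η j l = 0
  · rw [hz, abs_zero, zero_mul, zero_pow two_ne_zero]
    positivity
  have h3 : (|etaJ η j l| * p) ^ 2 ≤ p ^ 2 :=
    pow_le_pow_left₀ (by positivity) (mul_le_of_le_one_left hp (hη.abs_etaJ_le_one j l)) 2
  refine h3.trans ?_
  by_cases hj : j = 0
  · subst hj
    have hpK : p ≤ K := by nlinarith
    have : p ^ 2 ≤ K ^ 2 := pow_le_pow_left₀ hp hpK 2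
    simp only [pow_zero, inv_one, one_pow, mul_one]
    nlinarith [sq_nonneg K, mul_le_mul_of_nonneg_left hM (sq_nonneg K)]
  · have hl : (2 : ℝ) ^ j ≤ 2 * |l| := by
      by_contra! h
      exact hz (hη.etaJ_eq_zero_of_abs_lt hj h)
    have h4 := sq_mul_cube_le hp (abs_nonneg l) hM hK h1 (by rwa [sq_abs])
    have h5 : ((2 : ℝ) ^ j) ^ 3 ≤ (2 * |l|) ^ 3 := pow_le_pow_left₀ (by positivity) hl 3
    rw [inv_pow, ← div_eq_mul_inv, le_div_iff₀ (by positivity)]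
    calc p ^ 2 * ((2 : ℝ) ^ j) ^ 3 ≤ p ^ 2 * (2 * |l|) ^ 3 := by gcongr
      _ = 8 * (p ^ 2 * |l| ^ 3) := by ring
      _ ≤ 8 * (K ^ 2 * M) := by gcongr
      _ = _ := by ring

theorem IsBump.lintegral_etaJ_le (hη : IsBump η) {K M : ℝ} (hK : 0 ≤ K) (hM : 1 ≤ M)
    {h : ℝ → ℂ} (h1 : ∀ l, M * ‖h l‖ ≤ K) (h2 : ∀ l, l ^ 2 * ‖h l‖ ≤ K * M) (j : ℕ) :
    ∫⁻ l, ‖((etaJ η j l : ℝ) : ℂ) * h l‖ₑ ^ 2 ≤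
      ENNReal.ofReal ((6 * K * Real.sqrt M * ((2 : ℝ) ^ j)⁻¹) ^ 2) := by
  set b : ℝ := 8 * K ^ 2 * M * ((2 : ℝ) ^ j)⁻¹ ^ 3 with hb
  have hM0 : 0 ≤ M := by linarith
  have hb0 : 0 ≤ b := by positivity
  have hpt : ∀ l, ‖((etaJ η j l : ℝ) : ℂ) * h l‖ₑ ^ 2 ≤
      (Icc (-(2 : ℝ) ^ (j + 1)) (2 ^ (j + 1))).indicator (fun _ => ENNReal.ofReal b) l := by
    intro l
    by_cases hl : l ∈ Icc (-(2 : ℝ) ^ (j + 1)) (2 ^ (j + 1))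
    · rw [indicator_of_mem hl, ← ofReal_norm, ← ENNReal.ofReal_pow (norm_nonneg _), norm_mul,
        Complex.norm_real, Real.norm_eq_abs]
      exact ENNReal.ofReal_le_ofReal
        (hη.norm_sq_etaJ_mul_le hK hM (norm_nonneg _) j l (h1 l) (h2 l))
    · rw [hη.etaJ_eq_zero_of_lt (lt_of_not_ge fun h' => hl (abs_le.1 h'))]
      simp
  refine (lintegral_mono hpt).trans ?_
  rw [lintegral_indicator measurableSet_Icc, lintegral_const, Measure.restrict_apply_univ,
    Real.volume_Icc, ← ENNReal.ofReal_mul hb0]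
  refine ENNReal.ofReal_le_ofReal ?_
  rw [mul_pow, mul_pow, Real.sq_sqrt hM0, hb, pow_succ (2 : ℝ) j]
  have hp : (2 : ℝ) ^ j ≠ 0 := by positivity
  -- The pointwise bound is multiplied by the length `4 * 2 ^ j` of an interval containing the
  -- support; the resulting `32` is absorbed by `36 = 6 ^ 2`.
  have e : 8 * K ^ 2 * M * ((2 : ℝ) ^ j)⁻¹ ^ 3 * (2 ^ j * 2 - -(2 ^ j * 2)) =
      32 * (K ^ 2 * M * ((2 : ℝ) ^ j)⁻¹ ^ 2) := by
    field_simp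
    ring
  rw [e]
  have : 0 ≤ K ^ 2 * M * ((2 : ℝ) ^ j)⁻¹ ^ 2 := by positivity
  nlinarith

/-- The modulation sum of a time cutoff at scale `M⁻¹` is at most a multiple of `√M`. -/
theorem IsBump.exists_modulation_sum_bound (hη : IsBump η) :
    ∃ K : ℝ, 0 < K ∧ ∀ M : ℝ, 1 ≤ M → ∀ t₀ : ℝ,
      ∑' j : ℕ, ENNReal.ofReal ((2 : ℝ) ^ ((j : ℝ) / 2)) *
        (∫⁻ l, ‖((etaJ η j l : ℝ) : ℂ) *
          timeFourier (fun t => η (M * (t - t₀)) * η t) l‖ₑ ^ 2) ^ (1 / 2 : ℝ) ≤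
      ENNReal.ofReal (K * Real.sqrt M) := by
  obtain ⟨K, hK1, hK⟩ := hη.exists_timeFourier_bound
  -- The weight `2^{j/2}` times the block norm `2^{-j} √M` leaves a geometric series of ratio
  -- `2^{-1/2}`. Splitting at `2 ^ j ≈ M` would give a bound independent of `M`, but `√M` suffices
  -- for `a < 1`.
  set q : ℝ := (2 : ℝ) ^ (-(1 / 2) : ℝ) with hq
  have hq0 : 0 < q := by positivity
  have hq1 : q < 1 := Real.rpow_lt_one_of_one_lt_of_neg (by norm_num) (by norm_num)
  have hS := summable_geometric_of_lt_one hq0.le hq1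
  have hS0 : 0 < ∑' j : ℕ, q ^ j := hS.tsum_pos (fun j => by positivity) 0 (by simp)
  refine ⟨6 * K * ∑' j : ℕ, q ^ j, by positivity, fun M hM t₀ => ?_⟩
  have hterm : ∀ j : ℕ, ENNReal.ofReal ((2 : ℝ) ^ ((j : ℝ) / 2)) *
        (∫⁻ l, ‖((etaJ η j l : ℝ) : ℂ) *
          timeFourier (fun t => η (M * (t - t₀)) * η t) l‖ₑ ^ 2) ^ (1 / 2 : ℝ) ≤
      ENNReal.ofReal (6 * K * Real.sqrt M * q ^ j) := by
    intro j
    have h1 := hη.lintegral_etaJ_le (K := K) (by linarith) hM (fun l => (hK M hM t₀ l).1)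
      (fun l => (hK M hM t₀ l).2) j
    have hnn : 0 ≤ 6 * K * Real.sqrt M * ((2 : ℝ) ^ j)⁻¹ := by positivity
    have h2 := ENNReal.rpow_le_rpow h1 (show (0 : ℝ) ≤ 1 / 2 by norm_num)
    rw [ENNReal.ofReal_rpow_of_nonneg (by positivity) (by norm_num), ← Real.sqrt_eq_rpow,
      Real.sqrt_sq hnn] at h2
    refine (mul_le_mul_right h2 _).trans ?_
    rw [← ENNReal.ofReal_mul (by positivity)]
    refine ENNReal.ofReal_le_ofReal (le_of_eq ?_)
    have e : (2 : ℝ) ^ ((j : ℝ) / 2) * ((2 : ℝ) ^ j)⁻¹ = q ^ j := by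
      rw [hq, ← Real.rpow_natCast, ← Real.rpow_natCast, ← Real.rpow_neg (by norm_num),
        ← Real.rpow_add (by norm_num), ← Real.rpow_mul (by norm_num)]
      congr 1
      ring
    rw [← e]
    ring
  refine (ENNReal.tsum_le_tsum hterm).trans ?_
  rw [← ENNReal.ofReal_tsum_of_nonneg (fun j => by positivity) (hS.mul_left _), tsum_mul_left]
  exact ENNReal.ofReal_le_ofReal (le_of_eq (by ring))

/-! ### Free Schrödinger evolutions and their space-time Fourier transforms -/

/-- The unimodular factor `e^{i c |ξ|²}` at `ξ = 2π y`. -/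
def phase (c : ℝ) (y : Space d) : ℂ :=
  Complex.exp (Complex.I * ((c * ‖(2 * Real.pi) • y‖ ^ 2 : ℝ) : ℂ))

theorem continuous_phase_uncurry : Continuous fun p : ℝ × Space d => phase p.1 p.2 := by
  unfold phase
  exact Complex.continuous_exp.comp
    (continuous_const.mul (Complex.continuous_ofReal.comp (by fun_prop)))

theorem continuous_phase (c : ℝ) : Continuous (phase (d := d) c) :=
  continuous_phase_uncurry.comp (by fun_prop : Continuous fun y : Space d => (c, y))

theorem norm_phase (c : ℝ) (y : Space d) : ‖phase c y‖ = 1 := by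
  rw [phase, mul_comm, Complex.norm_exp_ofReal_mul_I]

theorem phase_add (b c : ℝ) (y : Space d) : phase (b + c) y = phase b y * phase c y := by
  rw [phase, phase, phase, ← Complex.exp_add]
  congr 1
  push_cast
  ring

theorem norm_phase_sub_le (b c : ℝ) (y : Space d) :
    ‖phase b y - phase c y‖ ≤ |b - c| * ‖(2 * Real.pi) • y‖ ^ 2 := by
  have h : phase b y - phase c y = phase c y * (phase (b - c) y - 1) := by
    rw [mul_sub, ← phase_add, mul_one, add_sub_cancel]
  rw [h, norm_mul, norm_phase, one_mul, phase]
  refine Real.norm_exp_I_mul_ofReal_sub_one_le.trans_eq ?_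
  rw [Real.norm_eq_abs, abs_mul, abs_of_nonneg (sq_nonneg ‖(2 * Real.pi) • y‖)]

theorem IsBddSupp.phase_mul {F : Space d → ℂ} (hF : IsBddSupp F) (c : ℝ) :
    IsBddSupp fun y => phase c y * F y :=
  hF.mul_continuous (continuous_phase c)

/-- The free Schrödinger evolution `e^{i t σ Δ}` of `synth F`. -/
def free (σ : ℝ) (F : Space d → ℂ) (t : ℝ) : L2 d := synth fun y => phase (-(t * σ)) y * F y

theorem norm_synth_le {F G : Space d → ℂ} (hF : IsBddSupp F) (hG : IsBddSupp G) {c : ℝ}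
    (h : ∀ y, ‖F y‖ ≤ c * ‖G y‖) : ‖synth F‖ ≤ c * ‖synth G‖ := by
  rw [synth_eq hF, synth_eq hG]
  have e : ∀ u : L2 d, ‖(𝓕⁻ u : L2 d)‖ = ‖u‖ :=
    (Lp.fourierTransformₗᵢ (Space d) ℂ).symm.norm_map
  rw [e, e]
  refine Lp.norm_le_mul_norm_of_ae_le_mul ?_
  filter_upwards [(hF.memLp volume 2).coeFn_toLp, (hG.memLp volume 2).coeFn_toLp] with y h1 h2
  rw [h1, h2]
  exact h y

/-- Bounded frequency support makes the evolution Lipschitz in time with values in `L²`. -/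
theorem continuous_free (σ : ℝ) {F : Space d → ℂ} (hF : IsBddSupp F) :
    Continuous (free σ F) := by
  obtain ⟨R, hR0, hR, hs⟩ := hF.bound
  have key : ∀ t s, ‖free σ F t - free σ F s‖ ≤
      (|σ| * (2 * Real.pi * R) ^ 2 * ‖synth F‖) * ‖t - s‖ := by
    intro t s
    rw [free, free, synth_sub (hF.phase_mul _) (hF.phase_mul _)]
    have h := norm_synth_le ((hF.phase_mul (-(t * σ))).sub (hF.phase_mul (-(s * σ)))) hF
      (c := |t - s| * |σ| * (2 * Real.pi * R) ^ 2) fun y => ?_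
    · refine h.trans_eq ?_
      rw [Real.norm_eq_abs]
      ring
    · by_cases hy : R < ‖y‖
      · simp [hs y hy]
      · rw [← sub_mul, norm_mul]
        gcongr
        refine (norm_phase_sub_le _ _ y).trans ?_
        have e : -(t * σ) - -(s * σ) = -((t - s) * σ) := by ring
        rw [e, abs_neg, abs_mul, norm_smul, Real.norm_of_nonneg (by positivity)]
        gcongr
        exact not_lt.1 hy
  rw [continuous_iff_continuousAt]
  intro s
  rw [ContinuousAt, tendsto_iff_norm_sub_tendsto_zero]
  refine squeeze_zero (fun _ => norm_nonneg _) (fun t => key t s) ?_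
  have : Continuous fun t : ℝ => (|σ| * (2 * Real.pi * R) ^ 2 * ‖synth F‖) * ‖t - s‖ := by
    fun_prop
  simpa using this.tendsto s

theorem continuous_timeFourier {ρ : ℝ → ℝ} (hρ : Integrable ρ) : Continuous (timeFourier ρ) := by
  have h : Continuous (𝓕 (fun t => (ρ t : ℂ))) :=
    VectorFourier.fourierIntegral_continuous Real.continuous_fourierChar
      (by exact continuous_inner) hρ.ofReal
  have : timeFourier ρ = fun l => 𝓕 (fun t => (ρ t : ℂ)) (l / (2 * Real.pi)) :=
    funext (timeFourier_eq ρ)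
  rw [this]
  exact h.comp (by fun_prop)

theorem IsBddSupp.timeFourier_mul {ρ : ℝ → ℝ} (hρ : Integrable ρ) {F : Space d → ℂ}
    (hF : IsBddSupp F) (τ σ : ℝ) :
    IsBddSupp fun y => timeFourier ρ (τ + σ * ‖(2 * Real.pi) • y‖ ^ 2) * F y :=
  hF.mul_continuous ((continuous_timeFourier hρ).comp (by fun_prop))

/-- The transform in time of `ρ(t) e^{-itσ|ξ|²}` is that of `ρ` evaluated at `τ + σ|ξ|²`. The
Bochner integral is identified by pairing with Schwartz functions and applying Fubini. -/
theorem integral_free {ρ : ℝ → ℝ} (hρ : Continuous ρ) (hρc : HasCompactSupport ρ)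
    {F : Space d → ℂ} (hF : IsBddSupp F) (τ σ : ℝ) :
    ∫ t : ℝ, Complex.exp (-(Complex.I * t * τ)) • ((ρ t : ℂ) • free σ F t) =
      synth fun y => timeFourier ρ (τ + σ * ‖(2 * Real.pi) • y‖ ^ 2) * F y := by
  have hρi : Integrable ρ := hρ.integrable_of_hasCompactSupport hρc
  have hco : Continuous fun t : ℝ =>
      Complex.exp (-(Complex.I * t * τ)) • ((ρ t : ℂ) • free σ F t) := by
    have := continuous_free σ hF
    have h1 : Continuous fun t : ℝ => Complex.exp (-(Complex.I * t * τ)) := by fun_prop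
    exact h1.smul ((Complex.continuous_ofReal.comp hρ).smul this)
  have hint : Integrable fun t : ℝ =>
      Complex.exp (-(Complex.I * t * τ)) • ((ρ t : ℂ) • free σ F t) := by
    refine hco.integrable_of_hasCompactSupport (hρc.mono fun t ht => ?_)
    contrapose! ht
    have : ρ t = 0 := by simpa using ht
    rw [Function.notMem_support, this, Complex.ofReal_zero, zero_smul ℂ (free σ F t), smul_zero]
  refine toTemperedDistribution_injective ?_
  ext φ
  rw [synth_dist_apply (hF.timeFourier_mul hρi τ σ)]
  -- Pairing with `φ` is a continuous linear functional on `L²`, hence commutes with the Bochner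
  -- integral.
  set L : L2 d →L[ℂ] ℂ := (PointwiseConvergenceCLM.evalCLM (RingHom.id ℂ) ℂ φ).comp
    (Lp.toTemperedDistributionCLM ℂ (volume : Measure (Space d)) 2) with hL
  have hLa : ∀ u : L2 d, (u : 𝓢'(Space d, ℂ)) φ = L u := fun u => rfl
  rw [hLa, ← L.integral_comp_comm hint]
  set ψ : Space d → ℂ := ⇑(𝓕⁻ φ : 𝓢(Space d, ℂ)) with hψ
  have hψc : Continuous ψ := (𝓕⁻ φ : 𝓢(Space d, ℂ)).continuous
  have h1 : ∀ t : ℝ, L (Complex.exp (-(Complex.I * t * τ)) • ((ρ t : ℂ) • free σ F t)) =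
      ∫ y, Complex.exp (-(Complex.I * t * τ)) * ((ρ t : ℂ) * (phase (-(t * σ)) y * F y * ψ y)) :=
      fun t => by
    rw [map_smul, map_smul, ← hLa, free, synth_dist_apply (hF.phase_mul _), smul_eq_mul,
      smul_eq_mul, ← integral_const_mul, ← integral_const_mul]
  simp_rw [h1]
  rw [integral_integral_swap]
  · refine integral_congr_ae (ae_of_all _ fun y => ?_)
    simp only [timeFourier]
    rw [mul_assoc, ← integral_mul_const]
    refine integral_congr_ae (ae_of_all _ fun t => ?_)
    have e : Complex.exp (-(Complex.I * t * ((τ + σ * ‖(2 * Real.pi) • y‖ ^ 2 : ℝ) : ℂ))) =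
        Complex.exp (-(Complex.I * t * τ)) * phase (-(t * σ)) y := by
      rw [phase, ← Complex.exp_add]
      congr 1
      push_cast
      ring
    simp only [e]
    ring
  · have hFψ : Integrable fun y => F y * ψ y := by
      simpa only [mul_comm] using (hF.mul_continuous hψc).integrable volume
    have hprod : Integrable (fun z : ℝ × Space d => (ρ z.1 : ℂ) * (F z.2 * ψ z.2))
        (volume.prod volume) := (Integrable.ofReal (𝕜 := ℂ) hρi).mul_prod hFψ
    have hc : Continuous fun p : ℝ × Space d =>
        Complex.exp (-(Complex.I * p.1 * τ)) * phase (-(p.1 * σ)) p.2 := by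
      refine Continuous.mul (by fun_prop) ?_
      exact continuous_phase_uncurry.comp
        (by fun_prop : Continuous fun p : ℝ × Space d => (-(p.1 * σ), p.2))
    refine (hprod.bdd_mul (c := 1) hc.aestronglyMeasurable (ae_of_all _ fun p => ?_)).congr
      (ae_of_all _ fun p => ?_)
    · have e : -(Complex.I * p.1 * τ) = ((-(p.1 * τ) : ℝ) : ℂ) * Complex.I := by push_cast; ring
      rw [norm_mul, norm_phase, e, Complex.norm_exp_ofReal_mul_I, one_mul]
    · simp only [Function.uncurry]
      ring

theorem spaceTimeFourier_free {ρ : ℝ → ℝ} (hρ : Continuous ρ) (hρc : HasCompactSupport ρ)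
    {F : Space d → ℂ} (hF : IsBddSupp F) (τ σ : ℝ) :
    ∀ᵐ ξ, spaceTimeFourier (fun t => (ρ t : ℂ) • free σ F t) τ ξ =
      (((2 * Real.pi) ^ (-(1 : ℝ) / 2) * (2 * Real.pi) ^ (-(d : ℝ) / 2) : ℝ) : ℂ) *
        (timeFourier ρ (τ + σ * ‖ξ‖ ^ 2) * F ((2 * Real.pi)⁻¹ • ξ)) := by
  have hρi : Integrable ρ := hρ.integrable_of_hasCompactSupport hρc
  filter_upwards [spaceFourier_synth (hF.timeFourier_mul hρi τ σ)] with ξ hξ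
  rw [spaceTimeFourier, integral_free hρ hρc hF, hξ, smul_inv_smul₀ (by positivity),
    Complex.ofReal_mul, mul_assoc]

/-- The factor by which Fourier normalizations enter `X_{N,σ}` norms. -/
def normConst (d : ℕ) : ℝ :=
  (2 * Real.pi) ^ (-(1 : ℝ) / 2) * (2 * Real.pi) ^ (-(d : ℝ) / 2) *
    Real.sqrt ((2 * Real.pi) ^ d)

theorem lintegral_scaled {F : Space d → ℂ} (hF : IsBddSupp F) :
    ∫⁻ ξ, ‖(((2 * Real.pi) ^ (-(1 : ℝ) / 2) * (2 * Real.pi) ^ (-(d : ℝ) / 2) : ℝ) : ℂ) *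
        F ((2 * Real.pi)⁻¹ • ξ)‖ₑ ^ 2 =
      (ENNReal.ofReal (normConst d) * ‖synth F‖ₑ) ^ 2 := by
  set c : ℝ := (2 * Real.pi) ^ (-(1 : ℝ) / 2) * (2 * Real.pi) ^ (-(d : ℝ) / 2) with hc
  have hpi := Real.pi_pos
  have hc0 : 0 ≤ c := by positivity
  have h1 : ∫⁻ ξ : Space d, ‖F ((2 * Real.pi)⁻¹ • ξ)‖ₑ ^ 2 =
      ENNReal.ofReal ((2 * Real.pi) ^ d) * ∫⁻ y, ‖F y‖ₑ ^ 2 := by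
    have hm : Measurable fun y => ‖F y‖ₑ ^ 2 := hF.measurable.enorm.pow_const 2
    have h2 := lintegral_map (μ := (volume : Measure (Space d))) hm
      (measurable_const_smul ((2 * Real.pi)⁻¹))
    rw [← h2, Measure.map_addHaar_smul _ (by positivity), lintegral_smul_measure, smul_eq_mul]
    congr 2
    rw [inv_pow, inv_inv, finrank_euclideanSpace_fin, abs_of_pos (by positivity)]
  simp_rw [enorm_mul, mul_pow]
  rw [lintegral_const_mul' _ _ (by finiteness), h1, enorm_synth hF, ← ENNReal.rpow_natCast
    (_ ^ (1 / 2 : ℝ)), ← ENNReal.rpow_mul]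
  norm_num
  rw [← mul_assoc]
  congr 1
  rw [← ofReal_norm, Complex.norm_real, Real.norm_of_nonneg hc0, ← ENNReal.ofReal_pow hc0,
    ← ENNReal.ofReal_mul (by positivity), normConst, ← hc, ← ENNReal.ofReal_pow (by positivity),
    mul_pow c, Real.sq_sqrt (by positivity)]

/-- For fixed `ξ`, the translation `l = τ + σ|ξ|²` removes the dispersion relation from the `τ`
integral, so each modulation block splits into a time factor and a space factor. Neither depends on
`σ`. -/
theorem xNorm_free (hη : IsBump η) {ρ : ℝ → ℝ} (hρ : Continuous ρ) (hρc : HasCompactSupport ρ)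
    {F : Space d → ℂ} (hF : IsBddSupp F) (σ : ℝ) :
    xNorm η σ (spaceTimeFourier fun t => (ρ t : ℂ) • free σ F t) =
      (∑' j : ℕ, ENNReal.ofReal ((2 : ℝ) ^ ((j : ℝ) / 2)) *
        (∫⁻ l, ‖((etaJ η j l : ℝ) : ℂ) * timeFourier ρ l‖ₑ ^ 2) ^ (1 / 2 : ℝ)) *
      (ENNReal.ofReal (normConst d) * ‖synth F‖ₑ) := by
  have hρi : Integrable ρ := hρ.integrable_of_hasCompactSupport hρc
  rw [xNorm, ← ENNReal.tsum_mul_right]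
  refine tsum_congr fun j => ?_
  rw [mul_assoc]
  congr 1
  have hηj : Continuous (etaJ η j) := by
    have := hη.smooth.continuous
    unfold etaJ
    split_ifs <;> fun_prop
  have hg : Measurable fun l : ℝ => ‖((etaJ η j l : ℝ) : ℂ) * timeFourier ρ l‖ₑ ^ 2 := by
    have := continuous_timeFourier hρi
    have h1 : Continuous fun l : ℝ => ((etaJ η j l : ℝ) : ℂ) * timeFourier ρ l :=
      (Complex.continuous_ofReal.comp hηj).mul this
    exact h1.measurable.enorm.pow_const 2
  have h1 : ∀ τ : ℝ, ∫⁻ ξ : Space d, ‖((etaJ η j (τ + σ * ‖ξ‖ ^ 2) : ℝ) : ℂ) *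
        spaceTimeFourier (fun t => (ρ t : ℂ) • free σ F t) τ ξ‖ₑ ^ 2 =
      ∫⁻ ξ : Space d, ‖((etaJ η j (τ + σ * ‖ξ‖ ^ 2) : ℝ) : ℂ) *
          timeFourier ρ (τ + σ * ‖ξ‖ ^ 2)‖ₑ ^ 2 *
        ‖(((2 * Real.pi) ^ (-(1 : ℝ) / 2) * (2 * Real.pi) ^ (-(d : ℝ) / 2) : ℝ) : ℂ) *
          F ((2 * Real.pi)⁻¹ • ξ)‖ₑ ^ 2 := fun τ => by
    refine lintegral_congr_ae ?_
    filter_upwards [spaceTimeFourier_free hρ hρc hF τ σ] with ξ hξ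
    rw [hξ, ← mul_pow, ← enorm_mul]
    congr 2
    ring
  simp_rw [h1]
  rw [lintegral_lintegral_swap]
  · have h2 : ∀ ξ : Space d, ∫⁻ τ : ℝ, ‖((etaJ η j (τ + σ * ‖ξ‖ ^ 2) : ℝ) : ℂ) *
          timeFourier ρ (τ + σ * ‖ξ‖ ^ 2)‖ₑ ^ 2 *
        ‖(((2 * Real.pi) ^ (-(1 : ℝ) / 2) * (2 * Real.pi) ^ (-(d : ℝ) / 2) : ℝ) : ℂ) *
          F ((2 * Real.pi)⁻¹ • ξ)‖ₑ ^ 2 =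
        (∫⁻ l, ‖((etaJ η j l : ℝ) : ℂ) * timeFourier ρ l‖ₑ ^ 2) *
        ‖(((2 * Real.pi) ^ (-(1 : ℝ) / 2) * (2 * Real.pi) ^ (-(d : ℝ) / 2) : ℝ) : ℂ) *
          F ((2 * Real.pi)⁻¹ • ξ)‖ₑ ^ 2 := fun ξ => by
      rw [lintegral_mul_const' _ _ (by finiteness)]
      congr 1
      exact lintegral_add_right_eq_self
        (fun l => ‖((etaJ η j l : ℝ) : ℂ) * timeFourier ρ l‖ₑ ^ 2) _
    simp_rw [h2]
    rw [lintegral_const_mul, lintegral_scaled hF, ENNReal.mul_rpow_of_nonneg _ _ (by norm_num),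
      ← ENNReal.rpow_natCast _ 2, ← ENNReal.rpow_mul]
    · norm_num
    · have := hF.measurable
      exact ((measurable_const.mul (this.comp (measurable_const_smul _))).enorm).pow_const 2
  · refine Measurable.aemeasurable ?_
    simp only [Function.uncurry_def]
    refine Measurable.mul (M := ℝ≥0∞) ?_ ?_
    · exact hg.comp (by fun_prop : Measurable fun p : ℝ × Space d => p.1 + σ * ‖p.2‖ ^ 2)
    · exact ((measurable_const.mul (hF.measurable.comp
        ((measurable_const_smul _).comp measurable_snd))).enorm).pow_const 2

theorem multiplier_free {F m : Space d → ℂ} (hF : IsBddSupp F)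
    (hm : (fun x => m ((2 * Real.pi) • x)).HasTemperateGrowth) (σ t : ℝ) :
    multiplier m ((free σ F t : L2 d) : 𝓢'(Space d, ℂ)) =
      ((free σ (fun y => m ((2 * Real.pi) • y) * F y) t : L2 d) : 𝓢'(Space d, ℂ)) := by
  rw [free, multiplier_synth (hF.phase_mul _) hm, free]
  congr 2
  ext y
  ring

theorem freqSupported_free {F : Space d → ℂ} (hF : IsBddSupp F) {k : ℕ}
    (hs : ∀ y, F y ≠ 0 → (2 * Real.pi) • y ∈ freqRegion d k) (σ T : ℝ) :
    FreqSupported T k (free σ F) := by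
  intro t _
  filter_upwards [spaceFourier_synth (hF.phase_mul (-(t * σ)))] with ξ hξ hk
  rw [free, hξ]
  have : F ((2 * Real.pi)⁻¹ • ξ) = 0 := by
    by_contra h
    have h1 := hs _ h
    rw [smul_inv_smul₀ (by positivity)] at h1
    exact hk h1
  rw [this, mul_zero, mul_zero]

/-! ### Upper bounds for the function-space norms of free solutions -/

/-- Localized free solutions have short-time norm at most a multiple of the square root of the
inverse of the time scale. -/
theorem IsBump.exists_localNorm_free_le (hη : IsBump η) (d : ℕ) :
    ∃ K : ℝ, 0 < K ∧ ∀ (a : ℝ), 0 < a → ∀ T : ℝ, 0 < T → T ≤ 1 → ∀ (σ : ℝ) (k : ℕ)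
      (F : Space d → ℂ), IsBddSupp F → (∀ y, F y ≠ 0 → (2 * Real.pi) • y ∈ freqRegion d k) →
      localNorm η a σ T k (toDist (free σ F)) ≤
        ENNReal.ofReal (K * Real.sqrt (((2 : ℝ) ^ k) ^ a * T⁻¹)) * ‖synth F‖ₑ := by
  obtain ⟨K, hK0, hK⟩ := hη.exists_modulation_sum_bound
  have hnc : 0 < normConst d := by
    have := Real.pi_pos
    unfold normConst
    positivity
  refine ⟨K * normConst d, by positivity, fun a ha T hT0 hT1 σ k F hF hs => ?_⟩
  set M : ℝ := ((2 : ℝ) ^ k) ^ a * T⁻¹ with hM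
  have hM1 : 1 ≤ M := one_le_mul_of_one_le_of_one_le
    (Real.one_le_rpow (one_le_pow₀ (by norm_num)) ha.le) ((one_le_inv₀ hT0).2 hT1)
  have hηc : Continuous η := hη.smooth.continuous
  -- The extension witnessing the infimum: `η = 1` on `[0, T]` because `T ≤ 1 < 4 / 3`, and its
  -- support `[-5/3, 5/3]` lies in `[-4, 4]`.
  set u : ℝ → L2 d := fun t => (η t : ℂ) • free σ F t with hu
  have hshort : shortNorm η a σ T k u ≤
      ENNReal.ofReal (K * normConst d * Real.sqrt M) * ‖synth F‖ₑ := by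
    refine iSup_le fun tN => ?_
    have e : (fun t => ((etaJ η 0 (((2 : ℝ) ^ k) ^ a * T⁻¹ * (t - tN)) : ℝ) : ℂ) • u t) =
        fun t => ((η (M * (t - tN)) * η t : ℝ) : ℂ) • free σ F t := by
      ext1 t
      rw [hu, etaJ, if_pos rfl, Complex.ofReal_mul, mul_smul]
    rw [e, xNorm_free (ρ := fun t => η (M * (t - tN)) * η t) hη (by fun_prop)
      (hη.hasCompactSupport.mul_left (f := fun t => η (M * (t - tN)))) hF]
    refine (mul_le_mul_left (hK M hM1 tN) _).trans_eq ?_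
    rw [← mul_assoc, ← ENNReal.ofReal_mul (by positivity)]
    congr 2
    ring
  have hmem : MemShort η a σ T k u := by
    refine ⟨(Complex.continuous_ofReal.comp hηc).smul (continuous_free σ hF), fun t ht => ?_,
      fun τ => ?_, hshort.trans_lt (by finiteness)⟩
    · have : η t = 0 := by
        refine hη.eq_zero (lt_of_not_ge fun h => ht ?_)
        rw [abs_le] at h
        exact ⟨by linarith, by linarith⟩
      rw [hu]
      simp only [this, Complex.ofReal_zero]
      exact zero_smul ℂ _
    · filter_upwards [spaceTimeFourier_free hηc hη.hasCompactSupport hF τ σ] with ξ hξ hk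
      rw [hu, hξ]
      have : F ((2 * Real.pi)⁻¹ • ξ) = 0 := by
        by_contra h
        have h1 := hs _ h
        rw [smul_inv_smul₀ (by positivity)] at h1
        exact hk h1
      rw [this, mul_zero, mul_zero]
  refine le_trans (iInf_le_of_le u (iInf_le_of_le hmem (iInf_le_of_le (fun t ht => ?_) le_rfl)))
    hshort
  have h1 : η t = 1 := hη.eq_one (by
    rw [abs_of_nonneg ht.1]
    linarith [ht.2])
  rw [hu, toDist]
  simp only [h1, Complex.ofReal_one]
  rw [one_smul ℂ (free σ F t)]

/-- The function `F` lives where `ψ_N = 1`, `N = 2 ^ k`. -/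
def InCore (k : ℕ) (F : Space d → ℂ) : Prop :=
  ∀ y, F y ≠ 0 → (k = 0 ∨ 5 / 6 * 2 ^ k < ‖(2 * Real.pi) • y‖) ∧
    ‖(2 * Real.pi) • y‖ ≤ 4 / 3 * 2 ^ k

theorem InCore.mem_freqRegion {k : ℕ} {F : Space d → ℂ} (h : InCore k F) {y : Space d}
    (hy : F y ≠ 0) : (2 * Real.pi) • y ∈ freqRegion d k := by
  obtain ⟨h1, h2⟩ := h y hy
  have hp : (0 : ℝ) < 2 ^ k := by positivity
  unfold freqRegion
  split_ifs with hk
  · subst hk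
    simp only [pow_zero] at h2
    exact h2.trans (by norm_num)
  · have h1 := h1.resolve_left hk
    exact ⟨by linarith, by linarith⟩

theorem toDist_lpProj_free (hη : IsBump η) {k : ℕ} {F : Space d → ℂ} (hF : IsBddSupp F)
    (hs : InCore k F) (σ : ℝ) (l : ℕ) :
    (fun t => lpProj η l (toDist (free σ F) t)) =
      toDist (free σ fun y => if l = k then F y else 0) := by
  ext1 t
  rw [toDist, lpProj, multiplier_free hF (hη.hasTemperateGrowth_psi l), toDist]
  congr 2
  ext y
  by_cases hy : F y = 0
  · simp [hy]
  obtain ⟨h1, h2⟩ := hs y hy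
  split_ifs with hl
  · rw [hl, hη.psi_eq_one h1 h2, Complex.ofReal_one, one_mul]
  · rw [hη.psi_eq_zero hl h1 h2, Complex.ofReal_zero, zero_mul]

theorem memCH_free {F : Space d → ℂ} (hF : IsBddSupp F) (s σ T : ℝ) :
    MemCH s T (toDist (free σ F)) :=
  ⟨free σ _, (continuous_free σ (hF.mul_continuous
    (hasTemperateGrowth_bessel s).1.continuous)).continuousOn, fun t _ =>
    multiplier_free hF (hasTemperateGrowth_bessel s) σ t⟩

/-- Data on the plateau of `ψ_N` are fixed by `P_N` and killed by every other projection, so the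
`ℓ²` sum has a single term. -/
theorem IsBump.exists_fNorm_free_le (hη : IsBump η) (d : ℕ) :
    ∃ K : ℝ, 0 < K ∧ ∀ (a : ℝ), 0 < a → ∀ T : ℝ, 0 < T → T ≤ 1 → ∀ (s σ : ℝ) (k : ℕ)
      (F : Space d → ℂ), IsBddSupp F → InCore k F →
      MemF η s a σ T (toDist (free σ F)) ∧ fNorm η s a σ T (toDist (free σ F)) ≤
        ENNReal.ofReal (((2 : ℝ) ^ k) ^ s * (K * Real.sqrt (((2 : ℝ) ^ k) ^ a * T⁻¹))) *
          ‖synth F‖ₑ := by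
  obtain ⟨K, hK0, hK⟩ := hη.exists_localNorm_free_le d
  refine ⟨K, hK0, fun a ha T hT0 hT1 s σ k F hF hs => ?_⟩
  have hle : fNorm η s a σ T (toDist (free σ F)) ≤
      ENNReal.ofReal (((2 : ℝ) ^ k) ^ s * (K * Real.sqrt (((2 : ℝ) ^ k) ^ a * T⁻¹))) *
          ‖synth F‖ₑ := by
    have hl : ∀ l, l ≠ k → (ENNReal.ofReal (((2 : ℝ) ^ l) ^ s) *
        localNorm η a σ T l (fun t => lpProj η l (toDist (free σ F) t))) ^ 2 = 0 := by
      intro l hl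
      -- The localized bound for zero data shows that the other blocks vanish; the infimum is finite
      -- there because the zero curve is admissible.
      have h1 := hK a ha T hT0 hT1 σ l (fun _ => 0) IsBddSupp.zero (fun y h => absurd rfl h)
      rw [synth_zero, enorm_zero, mul_zero, nonpos_iff_eq_zero] at h1
      rw [toDist_lpProj_free hη hF hs]
      simp only [hl, if_false]
      rw [h1, mul_zero, zero_pow two_ne_zero]
    rw [fNorm, tsum_eq_single k hl, toDist_lpProj_free hη hF hs, ← ENNReal.rpow_natCast _ 2,
      ← ENNReal.rpow_mul]
    norm_num
    rw [ENNReal.ofReal_mul (by positivity), mul_assoc]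
    exact mul_le_mul_right (hK a ha T hT0 hT1 σ k F hF fun y hy => hs.mem_freqRegion hy) _
  exact ⟨⟨memCH_free hF s σ T, hle.trans_lt (by finiteness)⟩, hle⟩

/-! ### The product and the Duhamel term on the Fourier side -/

/-- The correlation `∫ F(w + z) conj(G(z)) dz`. -/
def corr (F G : Space d → ℂ) (w : Space d) : ℂ := ∫ z, F (w + z) * (starRingEnd ℂ) (G z)

theorem isBddSupp_corr_kernel {F G : Space d → ℂ} (hF : IsBddSupp F) (hG : IsBddSupp G) :
    IsBddSupp fun p : Space d × Space d => F (p.1 + p.2) * (starRingEnd ℂ) (G p.2) := by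
  obtain ⟨R, hR0, hR, hs⟩ := hF.bound
  obtain ⟨S, hS0, hS, ht⟩ := hG.bound
  refine ⟨(hF.measurable.comp (by fun_prop)).mul
    (Complex.continuous_conj.measurable.comp (hG.measurable.comp (by fun_prop))),
    max (R * S) (R + S), le_max_of_le_left (by positivity), fun p => ?_, fun p hp => ?_⟩
  · rw [norm_mul, RCLike.norm_conj]
    exact le_max_of_le_left (mul_le_mul (hR _) (hS _) (norm_nonneg _) hR0)
  · by_cases h2 : S < ‖p.2‖
    · rw [ht _ h2, map_zero, mul_zero]
    · have hp' := (le_max_right _ _).trans_lt hp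
      rw [Prod.norm_def, lt_max_iff] at hp'
      have h3 : R + S < ‖p.1‖ := hp'.resolve_right (by linarith)
      have h4 : ‖p.1‖ ≤ ‖p.1 + p.2‖ + ‖p.2‖ := by
        simpa using norm_sub_le (p.1 + p.2) p.2
      rw [hs _ (by linarith), zero_mul]

/-- The bound is uniform over all data dominated by `F` and `G`, so the time-dependent phases of
free solutions do not affect it. -/
theorem exists_corr_bound {F G : Space d → ℂ} (hF : IsBddSupp F) (hG : IsBddSupp G) :
    ∃ R : ℝ, 0 ≤ R ∧ ∀ F' G' : Space d → ℂ, (∀ y, ‖F' y‖ ≤ ‖F y‖) → (∀ y, ‖G' y‖ ≤ ‖G y‖) →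
      (∀ w, ‖corr F' G' w‖ ≤ R) ∧ ∀ w, R < ‖w‖ → corr F' G' w = 0 := by
  obtain ⟨R, hR0, hR, hs⟩ := hF.bound
  obtain ⟨S, hS0, hS, ht⟩ := hG.bound
  have hI0 : 0 ≤ ∫ z, ‖G z‖ := integral_nonneg fun _ => norm_nonneg _
  refine ⟨max (R * ∫ z, ‖G z‖) (R + S), le_max_of_le_left (by positivity),
    fun F' G' hF' hG' => ⟨fun w => le_max_of_le_left ?_, fun w hw => ?_⟩⟩
  · rw [← integral_const_mul]
    refine norm_integral_le_of_norm_le ((hG.integrable volume).norm.const_mul R)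
      (ae_of_all _ fun z => ?_)
    rw [norm_mul, RCLike.norm_conj]
    exact mul_le_mul ((hF' _).trans (hR _)) (hG' z) (norm_nonneg _) hR0
  · refine integral_eq_zero_of_ae (ae_of_all _ fun z => ?_)
    have hw' := (le_max_right _ _).trans_lt hw
    have h0 : ∀ {F F' : Space d → ℂ}, (∀ y, ‖F' y‖ ≤ ‖F y‖) → ∀ y, F y = 0 → F' y = 0 :=
      fun h y hy => norm_le_zero_iff.1 ((h y).trans_eq (by rw [hy, norm_zero]))
    by_cases h2 : S < ‖z‖
    · simp [h0 hG' z (ht z h2)]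
    · have h4 : ‖w‖ ≤ ‖w + z‖ + ‖z‖ := by simpa using norm_sub_le (w + z) z
      simp [h0 hF' _ (hs (w + z) (by linarith))]

theorem isBddSupp_corr {F G : Space d → ℂ} (hF : IsBddSupp F) (hG : IsBddSupp G) :
    IsBddSupp (corr F G) := by
  obtain ⟨R, hR0, h⟩ := exists_corr_bound hF hG
  obtain ⟨h1, h2⟩ := h F G (fun _ => le_rfl) fun _ => le_rfl
  refine ⟨?_, R, hR0, h1, h2⟩
  exact ((isBddSupp_corr_kernel hF hG).measurable.stronglyMeasurable.integral_prod_right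
    (ν := volume)).measurable

theorem fourierInv_corr {F G : Space d → ℂ} (hF : IsBddSupp F) (hG : IsBddSupp G) (x : Space d) :
    𝓕⁻ F x * (starRingEnd ℂ) (𝓕⁻ G x) = 𝓕⁻ (corr F G) x := by
  rw [Real.fourierInv_eq' (corr F G), Real.fourierInv_eq' G, ← integral_conj,
    ← integral_const_mul]
  have h1 : ∀ z : Space d, 𝓕⁻ F x * (starRingEnd ℂ)
      (Complex.exp (((2 * Real.pi * inner ℝ z x : ℝ) : ℂ) * Complex.I) • G z) =
      ∫ w, Complex.exp (((2 * Real.pi * inner ℝ w x : ℝ) : ℂ) * Complex.I) *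
        (F (w + z) * (starRingEnd ℂ) (G z)) := by
    intro z
    -- The substitution `y = w + z` turns the product of two exponentials into one at the output
    -- frequency `w = y - z`.
    have h2 := integral_add_right_eq_self (μ := (volume : Measure (Space d)))
      (fun y => Complex.exp (((2 * Real.pi * inner ℝ (y - z) x : ℝ) : ℂ) * Complex.I) *
        (F y * (starRingEnd ℂ) (G z))) z
    simp only [add_sub_cancel_right] at h2
    rw [h2, Real.fourierInv_eq', ← integral_mul_const]
    refine integral_congr_ae (ae_of_all _ fun y => ?_)
    simp only [smul_eq_mul, map_mul, ← Complex.exp_conj, Complex.conj_ofReal, Complex.conj_I]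
    rw [inner_sub_left, mul_sub, Complex.ofReal_sub, sub_mul, sub_eq_add_neg, Complex.exp_add]
    rw [mul_neg]
    ring
  simp_rw [h1]
  rw [integral_integral_swap]
  · refine integral_congr_ae (ae_of_all _ fun w => ?_)
    simp only [smul_eq_mul, corr]
    rw [integral_const_mul]
  · have h2 := ((isBddSupp_corr_kernel hF hG).mul_continuous
      (m := fun p : Space d × Space d =>
        Complex.exp (((2 * Real.pi * inner ℝ p.1 x : ℝ) : ℂ) * Complex.I))
      (Complex.continuous_exp.comp ((Complex.continuous_ofReal.comp
        (by fun_prop)).mul continuous_const))).integrable (volume.prod volume)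
    exact h2.swap

theorem mulConj_synth {F G : Space d → ℂ} (hF : IsBddSupp F) (hG : IsBddSupp G) :
    mulConj (synth F) (synth G) = ((synth (corr F G) : L2 d) : 𝓢'(Space d, ℂ)) := by
  ext φ
  rw [mulConj, Lp.toTemperedDistribution_apply, Lp.toTemperedDistribution_apply]
  refine integral_congr_ae ?_
  filter_upwards [Lp.coeFn_lpSMul (r := 1) (synth F) (star (synth G)), Lp.coeFn_star (synth G),
    coeFn_synth hF, coeFn_synth hG, coeFn_synth (isBddSupp_corr hF hG)] with x h1 h2 h3 h4 h5
  rw [h1, h5, ← fourierInv_corr hF hG, ← h3, ← h4]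
  simp [h2]

theorem lineDeriv_synth {F : Space d → ℂ} (hF : IsBddSupp F) (j : Fin d) :
    ∂_{EuclideanSpace.single j (1 : ℝ)} ((synth F : L2 d) : 𝓢'(Space d, ℂ)) =
      ((synth fun y => 2 * Real.pi * Complex.I * y j * F y : L2 d) : 𝓢'(Space d, ℂ)) := by
  have hm : Continuous fun y : Space d => 2 * Real.pi * Complex.I * ((y j : ℝ) : ℂ) := by fun_prop
  have hg : (fun x : Space d =>
      ((inner ℝ x (EuclideanSpace.single j (1 : ℝ)) : ℝ) : ℂ)).HasTemperateGrowth :=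
    Function.Complex.hasTemperateGrowth_ofReal.comp (Function.hasTemperateGrowth_inner_left _)
  rw [lineDeriv_eq_fourierMultiplierCLM]
  ext φ
  rw [smul_apply, fourierMultiplierCLM_apply_apply, synth_dist_apply hF,
    synth_dist_apply (hF.mul_continuous hm), FourierTransform.fourierInv_fourier_eq, smul_eq_mul,
    ← integral_const_mul]
  refine integral_congr_ae (ae_of_all _ fun y => ?_)
  simp only [SchwartzMap.smulLeftCLM_apply_apply hg, smul_eq_mul]
  have : inner ℝ y (EuclideanSpace.single j (1 : ℝ)) = y j := by
    simp [EuclideanSpace.inner_single_right]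
  rw [this]
  ring

theorem propagator_synth {F : Space d → ℂ} (hF : IsBddSupp F) (γ t : ℝ) :
    propagator γ t ((synth F : L2 d) : 𝓢'(Space d, ℂ)) = ((free γ F t : L2 d) : 𝓢'(Space d, ℂ)) := by
  have e : ∀ y : Space d, Complex.exp (-(Complex.I * t * γ *
      ((‖(2 * Real.pi) • y‖ ^ 2 : ℝ) : ℂ))) = phase (-(t * γ)) y := fun y => by
    rw [phase]
    congr 1
    push_cast
    ring
  have hm : (fun x : Space d => Complex.exp (-(Complex.I * t * γ *
      ((‖(2 * Real.pi) • x‖ ^ 2 : ℝ) : ℂ)))).HasTemperateGrowth := by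
    simp_rw [e]
    exact hasTemperateGrowth_propagator _
  rw [propagator, multiplier_synth hF hm, free]
  simp_rw [e]

/-- The infimum runs over exactly one `L²` representative, because distributions determine `L²`
functions. -/
theorem sobolevNorm_synth {F : Space d → ℂ} (hF : IsBddSupp F) (s : ℝ) :
    sobolevNorm s ((synth F : L2 d) : 𝓢'(Space d, ℂ)) =
      ‖synth fun y => (((1 + ‖(2 * Real.pi) • y‖ ^ 2) ^ (s / 2) : ℝ) : ℂ) * F y‖ₑ := by
  have h := multiplier_synth (m := fun ξ => (((1 + ‖ξ‖ ^ 2) ^ (s / 2) : ℝ) : ℂ)) hF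
    (hasTemperateGrowth_bessel s)
  refine le_antisymm (iInf_le_of_le _ (iInf_le_of_le h le_rfl)) ?_
  refine le_iInf fun u => le_iInf fun hu => ?_
  rw [bessel, h] at hu
  rw [toTemperedDistribution_injective hu]

/-- The spatial frequency side of the integrand of the Duhamel term. -/
def duhamelKernel (α β γ : ℝ) (j : Fin d) (F G : Space d → ℂ) (t : ℝ) (p : ℝ × Space d) : ℂ :=
  phase (-((t - p.1) * γ)) p.2 * (2 * Real.pi * Complex.I * p.2 j *
    corr (fun y => phase (-(p.1 * α)) y * F y) (fun y => phase (-(p.1 * β)) y * G y) p.2)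

variable {α β γ : ℝ} {j : Fin d} {F G : Space d → ℂ}

theorem measurable_duhamelKernel (hF : IsBddSupp F) (hG : IsBddSupp G) (t : ℝ) :
    Measurable (duhamelKernel α β γ j F G t) := by
  have hph : Measurable fun p : ℝ × Space d => phase p.1 p.2 := continuous_phase_uncurry.measurable
  have hFm := hF.measurable
  have hGm := hG.measurable
  have hk : Measurable fun q : (ℝ × Space d) × Space d =>
      (phase (-(q.1.1 * α)) (q.1.2 + q.2) * F (q.1.2 + q.2)) *
        (starRingEnd ℂ) (phase (-(q.1.1 * β)) q.2 * G q.2) := by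
    refine Measurable.mul (Measurable.mul ?_ (by fun_prop))
      (Complex.continuous_conj.measurable.comp (Measurable.mul ?_ (by fun_prop)))
    · exact hph.comp (by fun_prop :
        Measurable fun q : (ℝ × Space d) × Space d => (-(q.1.1 * α), q.1.2 + q.2))
    · exact hph.comp (by fun_prop :
        Measurable fun q : (ℝ × Space d) × Space d => (-(q.1.1 * β), q.2))
  refine Measurable.mul ?_ (Measurable.mul (by fun_prop) ?_)
  · exact hph.comp (by fun_prop :
      Measurable fun p : ℝ × Space d => (-((t - p.1) * γ), p.2))
  · exact (hk.stronglyMeasurable.integral_prod_right (ν := volume)).measurable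

theorem exists_duhamelKernel_bound (α β γ : ℝ) (j : Fin d) (hF : IsBddSupp F)
    (hG : IsBddSupp G) :
    ∃ B : ℝ, 0 ≤ B ∧ ∀ t p, ‖duhamelKernel α β γ j F G t p‖ ≤ B ∧
      (B < ‖p.2‖ → duhamelKernel α β γ j F G t p = 0) := by
  obtain ⟨R, hR0, h⟩ := exists_corr_bound hF hG
  have hpi := Real.pi_pos
  refine ⟨max R (2 * Real.pi * R * R), le_max_of_le_left hR0, fun t p => ?_⟩
  obtain ⟨h1, h2⟩ := h (fun y => phase (-(p.1 * α)) y * F y) (fun y => phase (-(p.1 * β)) y * G y)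
    (fun y => by rw [norm_mul, norm_phase, one_mul]) (fun y => by rw [norm_mul, norm_phase, one_mul])
  have hz : R < ‖p.2‖ → duhamelKernel α β γ j F G t p = 0 := fun hp => by
    rw [duhamelKernel, h2 _ hp, mul_zero, mul_zero]
  refine ⟨?_, fun hp => hz ((le_max_left _ _).trans_lt hp)⟩
  by_cases hp : R < ‖p.2‖
  · rw [hz hp, norm_zero]
    exact le_max_of_le_left hR0
  · refine le_max_of_le_right ?_
    rw [duhamelKernel, norm_mul, norm_phase, one_mul, norm_mul]
    refine mul_le_mul ?_ (h1 _) (norm_nonneg _) (by positivity)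
    rw [norm_mul, norm_mul, norm_mul, Complex.norm_I, Complex.norm_real, Complex.norm_real,
      Real.norm_of_nonneg hpi.le, mul_one, Complex.norm_ofNat]
    gcongr
    exact (PiLp.norm_apply_le p.2 j).trans (not_lt.1 hp)

/-- The spatial frequency side of the Duhamel term. -/
def duhamelHat (α β γ : ℝ) (j : Fin d) (F G : Space d → ℂ) (t : ℝ) (w : Space d) : ℂ :=
  ∫ t' in Ioc 0 t, duhamelKernel α β γ j F G t (t', w)

theorem exists_duhamelHat_bound (α β γ : ℝ) (j : Fin d) (hF : IsBddSupp F) (hG : IsBddSupp G) :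
    ∃ B : ℝ, 0 ≤ B ∧ ∀ t, 0 ≤ t → t ≤ 1 → ∀ w, ‖duhamelHat α β γ j F G t w‖ ≤ B ∧
      (B < ‖w‖ → duhamelHat α β γ j F G t w = 0) := by
  obtain ⟨B, hB0, hB⟩ := exists_duhamelKernel_bound α β γ j hF hG
  refine ⟨B, hB0, fun t ht0 ht1 w => ⟨?_, fun hw => ?_⟩⟩
  · refine (norm_setIntegral_le_of_norm_le_const (by simp) fun t' _ =>
      (hB t (t', w)).1).trans ?_
    rw [Real.volume_real_Ioc_of_le ht0, sub_zero]
    exact mul_le_of_le_one_right hB0 ht1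
  · exact integral_eq_zero_of_ae (ae_of_all _ fun t' => (hB t (t', w)).2 hw)

theorem isBddSupp_duhamelHat (hF : IsBddSupp F) (hG : IsBddSupp G) {t : ℝ} (ht0 : 0 ≤ t)
    (ht1 : t ≤ 1) : IsBddSupp (duhamelHat α β γ j F G t) := by
  obtain ⟨B, hB0, hB⟩ := exists_duhamelHat_bound α β γ j hF hG
  refine ⟨?_, B, hB0, fun w => (hB t ht0 ht1 w).1, fun w => (hB t ht0 ht1 w).2⟩
  exact (StronglyMeasurable.integral_prod_left
    (f := fun t' w => duhamelKernel α β γ j F G t (t', w))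
    (measurable_duhamelKernel hF hG t).stronglyMeasurable (μ := volume.restrict (Ioc 0 t))).measurable

theorem duhamel_integrand_apply (hF : IsBddSupp F) (hG : IsBddSupp G) (t t' : ℝ)
    (φ : 𝓢(Space d, ℂ)) :
    propagator γ (t - t') (∂_{EuclideanSpace.single j (1 : ℝ)}
      (mulConj (free α F t') (free β G t'))) φ =
      ∫ w, duhamelKernel α β γ j F G t (t', w) * (𝓕⁻ φ : 𝓢(Space d, ℂ)) w := by
  have hm : Continuous fun y : Space d => 2 * Real.pi * Complex.I * ((y j : ℝ) : ℂ) := by fun_prop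
  have hc := isBddSupp_corr (hF.phase_mul (-(t' * α))) (hG.phase_mul (-(t' * β)))
  rw [free, free, mulConj_synth (hF.phase_mul _) (hG.phase_mul _), lineDeriv_synth hc,
    propagator_synth (hc.mul_continuous hm), free,
    synth_dist_apply ((hc.mul_continuous hm).phase_mul _)]
  rfl

/-- Fubini in time and frequency: the kernel is uniformly bounded, and the transformed test function
is integrable. -/
theorem isDuhamel_synth (hF : IsBddSupp F) (hG : IsBddSupp G) {t : ℝ} (ht0 : 0 ≤ t)
    (ht1 : t ≤ 1) :
    IsDuhamel γ j (free α F) (free β G) t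
      ((synth (duhamelHat α β γ j F G t) : L2 d) : 𝓢'(Space d, ℂ)) := by
  intro φ
  obtain ⟨B, hB0, hB⟩ := exists_duhamelKernel_bound α β γ j hF hG
  set ψ : 𝓢(Space d, ℂ) := 𝓕⁻ φ with hψ
  have hint : Integrable (fun p : ℝ × Space d => duhamelKernel α β γ j F G t p * ψ p.2)
      ((volume.restrict (Ioc 0 t)).prod volume) := by
    have h1 : Integrable (fun p : ℝ × Space d => ψ p.2)
        ((volume.restrict (Ioc 0 t)).prod volume) := ψ.integrable.comp_snd _
    exact h1.bdd_mul (c := B) (measurable_duhamelKernel hF hG t).aestronglyMeasurable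
      (ae_of_all _ fun p => (hB t p).1)
  simp_rw [duhamel_integrand_apply hF hG]
  refine ⟨?_, ?_⟩
  · rw [intervalIntegrable_iff_integrableOn_Ioc_of_le ht0]
    exact hint.integral_prod_left
  · rw [synth_dist_apply (isBddSupp_duhamelHat hF hG ht0 ht1),
      intervalIntegral.integral_of_le ht0, integral_integral_swap hint]
    refine integral_congr_ae (ae_of_all _ fun w => ?_)
    simp only [duhamelHat]
    rw [integral_mul_const]

/-! ### Lower bounds by comparison with indicator functions -/

theorem isBddSupp_indicator {S : Set (Space d)} (hS : MeasurableSet S) {R : ℝ} (hR : 1 ≤ R)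
    (hb : ∀ y ∈ S, ‖y‖ ≤ R) : IsBddSupp (S.indicator fun _ => (1 : ℂ)) := by
  refine ⟨measurable_const.indicator hS, R, by linarith, fun y => ?_, fun y hy => ?_⟩
  · exact (norm_indicator_le_norm_self _ _).trans (by simpa using hR)
  · exact indicator_of_notMem (fun h => (not_le.2 hy) (hb y h)) _

theorem enorm_synth_indicator {S : Set (Space d)} (hS : MeasurableSet S)
    (h : IsBddSupp (S.indicator fun _ => (1 : ℂ))) (hf : volume S ≠ ⊤) :
    ‖synth (S.indicator fun _ => (1 : ℂ))‖ₑ = ENNReal.ofReal (Real.sqrt (volume.real S)) := by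
  have h1 : ∀ y, ‖S.indicator (fun _ => (1 : ℂ)) y‖ₑ ^ 2 = S.indicator (fun _ => 1) y := by
    intro y
    by_cases hy : y ∈ S <;> simp [hy]
  rw [enorm_synth h]
  simp_rw [h1]
  rw [lintegral_indicator hS, setLIntegral_one, Real.sqrt_eq_rpow,
    ← ENNReal.ofReal_rpow_of_nonneg measureReal_nonneg (by norm_num), ofReal_measureReal hf]

theorem le_enorm_synth {S : Set (Space d)} (hS : MeasurableSet S)
    (h : IsBddSupp (S.indicator fun _ => (1 : ℂ))) (hf : volume S ≠ ⊤) {F : Space d → ℂ}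
    (hF : IsBddSupp F) {b : ℝ} (hb : 0 < b) (hbF : ∀ y ∈ S, b ≤ ‖F y‖) :
    ENNReal.ofReal (b * Real.sqrt (volume.real S)) ≤ ‖synth F‖ₑ := by
  have h1 : ‖synth (S.indicator fun _ => (1 : ℂ))‖ = Real.sqrt (volume.real S) := by
    have := enorm_synth_indicator hS h hf
    rw [← ofReal_norm] at this
    exact (ENNReal.ofReal_eq_ofReal_iff (norm_nonneg _) (Real.sqrt_nonneg _)).1 this
  have h2 := norm_synth_le (c := b⁻¹) h hF fun y => by
    by_cases hy : y ∈ S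
    · rw [indicator_of_mem hy, norm_one, ← div_eq_inv_mul, one_le_div hb]
      exact hbF y hy
    · rw [indicator_of_notMem hy, norm_zero]
      positivity
  rw [← ofReal_norm]
  refine ENNReal.ofReal_le_ofReal ?_
  rw [← h1]
  rwa [← div_eq_inv_mul, le_div_iff₀' hb] at h2

theorem const_mul_measureReal_le_re_integral {X : Type*} [MeasurableSpace X] {μ : Measure X}
    {s : Set X} (hs : MeasurableSet s) (hμ : μ s ≠ ⊤) {h : X → ℂ} (hi : IntegrableOn h s μ)
    {c : ℝ} (hc : ∀ x ∈ s, c ≤ (h x).re) : c * μ.real s ≤ (∫ x in s, h x ∂μ).re := by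
  have h1 : (∫ x in s, h x ∂μ).re = ∫ x in s, (h x).re ∂μ := (integral_re hi).symm
  rw [h1]
  have h2 := setIntegral_mono_on (integrableOn_const (C := c) hμ) hi.re hs hc
  rw [setIntegral_const, smul_eq_mul, mul_comm] at h2
  exact h2

/-! ### The resonance function and the lower bound for the Duhamel term -/

/-- The oscillating factor of the interaction. -/
def resonance (β γ : ℝ) (w : Space d) (p : ℝ × Space d) : ℂ :=
  phase (p.1 * γ) w * (phase (-(p.1 * γ)) (w + p.2) * (starRingEnd ℂ) (phase (-(p.1 * β)) p.2))

theorem continuous_resonance (β γ : ℝ) (w : Space d) : Continuous (resonance β γ w) := by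
  have h := continuous_phase_uncurry (d := d)
  refine Continuous.mul ?_ (Continuous.mul ?_ (Complex.continuous_conj.comp ?_))
  · exact h.comp (by fun_prop : Continuous fun p : ℝ × Space d => (p.1 * γ, w))
  · exact h.comp (by fun_prop : Continuous fun p : ℝ × Space d => (-(p.1 * γ), w + p.2))
  · exact h.comp (by fun_prop : Continuous fun p : ℝ × Space d => (-(p.1 * β), p.2))

theorem norm_resonance (β γ : ℝ) (w : Space d) (p : ℝ × Space d) : ‖resonance β γ w p‖ = 1 := by
  rw [resonance, norm_mul, norm_mul, RCLike.norm_conj, norm_phase, norm_phase, norm_phase]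
  norm_num

/-- Both the propagator and the high-frequency factor carry `γ`; expanding `|w + z|²` therefore
cancels `|w|²` and leaves only terms containing `z`. -/
theorem resonance_eq (β γ : ℝ) (w z : Space d) (t : ℝ) :
    resonance β γ w (t, z) = Complex.exp (Complex.I * ((t * ((2 * Real.pi) ^ 2 *
      ((β - γ) * ‖z‖ ^ 2 - 2 * γ * inner ℝ w z)) : ℝ) : ℂ)) := by
  have hpi := Real.pi_pos
  have hn : ∀ y : Space d, ‖(2 * Real.pi) • y‖ ^ 2 = (2 * Real.pi) ^ 2 * ‖y‖ ^ 2 := fun y => by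
    rw [norm_smul, mul_pow, Real.norm_of_nonneg (by positivity)]
  rw [resonance, phase, phase, phase, ← Complex.exp_conj, ← Complex.exp_add, ← Complex.exp_add,
    map_mul, Complex.conj_I, Complex.conj_ofReal, hn, hn, hn, norm_add_sq_real]
  congr 1
  push_cast
  ring

/-- Uses `cos θ ≥ 1 - θ² / 2`. A positive lower bound on the real part rules out cancellation in the
integral. -/
theorem half_le_re_resonance {β γ : ℝ} {w z : Space d} {t : ℝ}
    (h : |t * ((2 * Real.pi) ^ 2 * ((β - γ) * ‖z‖ ^ 2 - 2 * γ * inner ℝ w z))| ≤ 1) :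
    1 / 2 ≤ (resonance β γ w (t, z)).re := by
  rw [resonance_eq, mul_comm Complex.I, Complex.exp_ofReal_mul_I_re]
  refine le_trans ?_ (Real.one_sub_sq_div_two_le_cos)
  have := (sq_le_one_iff_abs_le_one _).2 h
  linarith

/-- When `w + B ⊆ A`, the cutoff to `A` is invisible. The `t`-dependent part of the propagator is
unimodular and leaves the integral, so only the resonance factor is integrated. -/
theorem duhamelHat_eq {β γ : ℝ} {j : Fin d} {A B : Set (Space d)} (hB : MeasurableSet B) (t : ℝ)
    {w : Space d} (hw : ∀ z ∈ B, w + z ∈ A) :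
    duhamelHat γ β γ j (A.indicator fun _ => 1) (B.indicator fun _ => 1) t w =
      phase (-(t * γ)) w * (2 * Real.pi * Complex.I * w j) *
        ∫ t' in Ioc 0 t, ∫ z in B, resonance β γ w (t', z) := by
  rw [duhamelHat, ← integral_const_mul]
  refine integral_congr_ae (ae_of_all _ fun t' => ?_)
  simp only [duhamelKernel, corr]
  have e1 : phase (-((t - t') * γ)) w = phase (-(t * γ)) w * phase (t' * γ) w := by
    rw [← phase_add]
    congr 1
    ring
  have e2 : ∀ z, phase (-(t' * γ)) (w + z) * A.indicator (fun _ => (1 : ℂ)) (w + z) *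
      (starRingEnd ℂ) (phase (-(t' * β)) z * B.indicator (fun _ => (1 : ℂ)) z) =
      B.indicator (fun z => phase (-(t' * γ)) (w + z) *
        (starRingEnd ℂ) (phase (-(t' * β)) z)) z := by
    intro z
    by_cases hz : z ∈ B
    · simp [hz, hw z hz]
    · simp [hz]
  simp_rw [e2]
  rw [integral_indicator hB, e1]
  simp only [resonance]
  rw [integral_const_mul]
  ring

theorem norm_duhamelHat_ge {β γ : ℝ} {j : Fin d} {A B : Set (Space d)} (hB : MeasurableSet B)
    (hBf : volume B ≠ ⊤) {t : ℝ} (ht : 0 ≤ t) {w : Space d} (hw : ∀ z ∈ B, w + z ∈ A)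
    (hres : ∀ t' ∈ Ioc 0 t, ∀ z ∈ B, 1 / 2 ≤ (resonance β γ w (t', z)).re) :
    2 * Real.pi * |w j| * (t / 2 * volume.real B) ≤
      ‖duhamelHat γ β γ j (A.indicator fun _ => 1) (B.indicator fun _ => 1) t w‖ := by
  have hpi := Real.pi_pos
  rw [duhamelHat_eq hB t hw, norm_mul, norm_mul, norm_phase, one_mul, norm_mul, norm_mul, norm_mul,
    Complex.norm_I, Complex.norm_real, Complex.norm_real, Complex.norm_ofNat,
    Real.norm_of_nonneg hpi.le, mul_one, Real.norm_eq_abs]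
  refine mul_le_mul_of_nonneg_left ?_ (by positivity)
  refine le_trans ?_ (Complex.re_le_norm _)
  have hfin : IsFiniteMeasure (volume.restrict B) := ⟨by simpa using hBf.lt_top⟩
  have hint : Integrable (resonance β γ w)
      ((volume.restrict (Ioc 0 t)).prod (volume.restrict B)) :=
    Integrable.of_bound (continuous_resonance β γ w).aestronglyMeasurable 1
      (ae_of_all _ fun p => (norm_resonance β γ w p).le)
  have h1 : ∀ t' ∈ Ioc 0 t, 1 / 2 * volume.real B ≤ (∫ z in B, resonance β γ w (t', z)).re := by
    intro t' ht'
    refine const_mul_measureReal_le_re_integral hB hBf ?_ (hres t' ht')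
    exact Integrable.of_bound ((continuous_resonance β γ w).comp
      (by fun_prop : Continuous fun z : Space d => (t', z))).aestronglyMeasurable 1
      (ae_of_all _ fun z => (norm_resonance β γ w (t', z)).le)
  have h2 := const_mul_measureReal_le_re_integral measurableSet_Ioc (by simp)
    hint.integral_prod_left h1
  rw [Real.volume_real_Ioc_of_le ht, sub_zero] at h2
  refine le_trans (le_of_eq ?_) h2
  ring

/-! ### Quantitative estimates for the slab, the Sobolev weight and the phase -/

theorem exists_slab_volume_ge (j : Fin d) {r : ℝ} (hr : 0 < r) :
    ∃ v : ℝ, 0 < v ∧ ∀ X : ℝ, 1 ≤ X →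
      v / X ≤ volume.real (Metric.ball (0 : Space d) r ∩ {z | |z j| ≤ r / X}) := by
  -- A box of half-sides at most `ρ` lies in the ball of radius `r`, since `√d ρ < r`; shrinking
  -- side `j` by `X` puts it in the slab at the cost of one factor `X` in volume.
  set ρ : ℝ := r / (d + 1) with hρ
  have hρ0 : 0 < ρ := by positivity
  refine ⟨(2 * ρ) ^ d, by positivity, fun X hX => ?_⟩
  have hX0 : 0 < X := by linarith
  set c : Fin d → ℝ := fun i => ρ * (if i = j then X⁻¹ else 1) with hc
  have hc1 : ∀ i, c i ≤ ρ := fun i => by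
    rw [hc]
    refine mul_le_of_le_one_right hρ0.le ?_
    split_ifs
    · exact inv_le_one_of_one_le₀ hX
    · exact le_rfl
  have hc0 : ∀ i, 0 ≤ c i := fun i => by
    rw [hc]
    refine mul_nonneg hρ0.le ?_
    split_ifs <;> positivity
  have hmp := PiLp.volume_preserving_ofLp (Fin d)
  have hvol := hmp.measure_preimage (measurableSet_Icc (a := fun i => -c i) (b := c)).nullMeasurableSet
  rw [Real.volume_Icc_pi] at hvol
  have hsub : WithLp.ofLp ⁻¹' (Icc (fun i => -c i) c) ⊆
      Metric.ball (0 : Space d) r ∩ {z | |z j| ≤ r / X} := by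
    intro z hz
    have hz' : ∀ i, |z i| ≤ c i := fun i => abs_le.2 ⟨hz.1 i, hz.2 i⟩
    refine ⟨?_, ?_⟩
    · rw [mem_ball_zero_iff, EuclideanSpace.norm_eq, Real.sqrt_lt' hr]
      calc ∑ i, ‖z i‖ ^ 2 ≤ ∑ _i : Fin d, ρ ^ 2 := Finset.sum_le_sum fun i _ =>
            pow_le_pow_left₀ (norm_nonneg _) ((hz' i).trans (hc1 i)) 2
        _ = d * ρ ^ 2 := by simp
        _ < (d + 1) ^ 2 * ρ ^ 2 := by
            have : (0 : ℝ) ≤ d := Nat.cast_nonneg d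
            exact mul_lt_mul_of_pos_right (by nlinarith) (by positivity)
        _ = r ^ 2 := by rw [hρ]; field_simp
    · refine (hz' j).trans ?_
      rw [hc]
      simp only [if_true]
      rw [← div_eq_mul_inv]
      gcongr
      rw [hρ]
      exact div_le_self hr.le (by linarith [Nat.cast_nonneg (α := ℝ) d])
  have hprod : ∏ i, ENNReal.ofReal (c i - -c i) = ENNReal.ofReal ((2 * ρ) ^ d / X) := by
    rw [← ENNReal.ofReal_prod_of_nonneg (fun i _ => by linarith [hc0 i])]
    congr 1
    have : ∀ i, c i - -c i = (2 * ρ) * (if i = j then X⁻¹ else 1) := fun i => by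
      simp only [hc]
      ring
    simp_rw [this]
    rw [Finset.prod_mul_distrib]
    simp [div_eq_mul_inv]
  rw [hprod] at hvol
  have hle := measure_mono (μ := volume) hsub
  rw [hvol] at hle
  refine (ENNReal.ofReal_le_iff_le_toReal ?_).1 hle
  exact ((measure_mono inter_subset_left).trans_lt measure_ball_lt_top).ne

/-- The quotient `(1 + x²) / X²` lies in `[1/4, 4]`, so its power `s / 2` is at least `4^{-|s|/2}`
for either sign of `s`. -/
theorem bessel_weight_ge {X x : ℝ} (s : ℝ) (hX : 1 ≤ X) (h1 : 1 / 2 * X ≤ x) (h2 : x ≤ 4 / 3 * X) :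
    (4 : ℝ) ^ (-(|s| / 2)) * X ^ s ≤ (1 + x ^ 2) ^ (s / 2) := by
  have hX0 : 0 < X := by linarith
  set q : ℝ := (1 + x ^ 2) / X ^ 2 with hq
  have hq1 : 1 / 4 ≤ q := by
    rw [hq, le_div_iff₀ (by positivity)]
    nlinarith
  have hq2 : q ≤ 4 := by
    rw [hq, div_le_iff₀ (by positivity)]
    nlinarith
  have hq0 : 0 < q := by linarith
  have e : (1 + x ^ 2) ^ (s / 2) = q ^ (s / 2) * X ^ s := by
    have : 1 + x ^ 2 = q * X ^ (2 : ℝ) := by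
      rw [hq, Real.rpow_two]
      field_simp
    rw [this, Real.mul_rpow hq0.le (by positivity), ← Real.rpow_mul hX0.le]
    congr 2
    ring
  rw [e]
  refine mul_le_mul_of_nonneg_right ?_ (by positivity)
  rcases le_total 0 s with hs | hs
  · rw [abs_of_nonneg hs, Real.rpow_neg (by norm_num), ← Real.inv_rpow (by norm_num)]
    exact Real.rpow_le_rpow (by norm_num) (by linarith) (by linarith)
  · rw [abs_of_nonpos hs, neg_div, neg_neg]
    exact Real.rpow_le_rpow_of_nonpos hq0 hq2 (by linarith)

theorem iSup_sobolevNorm_duhamel_lt_top {α β γ : ℝ} {j : Fin d} {F G : Space d → ℂ}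
    (hF : IsBddSupp F) (hG : IsBddSupp G) (s : ℝ) {T : ℝ} (hT : T ≤ 1) :
    (⨆ t ∈ Icc 0 T, sobolevNorm s
      ((synth (duhamelHat α β γ j F G t) : L2 d) : 𝓢'(Space d, ℂ))) < ⊤ := by
  obtain ⟨B, hB0, hB⟩ := exists_duhamelHat_bound α β γ j hF hG
  have hwc : Continuous fun y : Space d =>
      (((1 + ‖(2 * Real.pi) • y‖ ^ 2) ^ (s / 2) : ℝ) : ℂ) :=
    (hasTemperateGrowth_bessel s).1.continuous
  obtain ⟨K, hK⟩ := (isCompact_closedBall (0 : Space d) B).exists_bound_of_continuousOn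
    hwc.continuousOn
  have hK0 : 0 ≤ K := (norm_nonneg _).trans (hK 0 (by simpa using hB0))
  have hI : IsBddSupp ((Metric.closedBall (0 : Space d) B).indicator fun _ => (1 : ℂ)) :=
    isBddSupp_indicator Metric.isClosed_closedBall.measurableSet (le_max_left 1 B) fun y hy =>
      (mem_closedBall_zero_iff.1 hy).trans (le_max_right _ _)
  refine lt_of_le_of_lt (b := ENNReal.ofReal (K * B *
    ‖synth ((Metric.closedBall (0 : Space d) B).indicator fun _ => (1 : ℂ))‖))
    (iSup₂_le fun t ht => ?_) ENNReal.ofReal_lt_top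
  have hW := isBddSupp_duhamelHat (α := α) (β := β) (γ := γ) (j := j) hF hG ht.1 (ht.2.trans hT)
  rw [sobolevNorm_synth hW, ← ofReal_norm]
  refine ENNReal.ofReal_le_ofReal (norm_synth_le (hW.mul_continuous hwc) hI fun y => ?_)
  obtain ⟨h1, h2⟩ := hB t ht.1 (ht.2.trans hT) y
  by_cases hy : y ∈ Metric.closedBall (0 : Space d) B
  · rw [indicator_of_mem hy, norm_one, mul_one, norm_mul]
    exact mul_le_mul (hK y hy) h1 (norm_nonneg _) hK0
  · rw [h2 (by simpa using hy), mul_zero, norm_zero]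
    positivity

theorem exists_growth {a : ℝ} (ha : a < 1) (E : ℝ) {E' : ℝ} (hE' : 0 < E') (k₀ : ℕ) :
    ∃ k : ℕ, k₀ ≤ k ∧ E < E' * ((2 : ℝ) ^ k) ^ ((1 - a) / 2) := by
  have h1 : 1 < (2 : ℝ) ^ ((1 - a) / 2) := Real.one_lt_rpow (by norm_num) (by linarith)
  have h2 := (tendsto_pow_atTop_atTop_of_one_lt h1).eventually_gt_atTop (E / E')
  obtain ⟨k, hk, hk₀⟩ := (h2.and (eventually_ge_atTop k₀)).exists
  refine ⟨k, hk₀, ?_⟩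
  rw [div_lt_iff₀' hE'] at hk
  have e : ((2 : ℝ) ^ k) ^ ((1 - a) / 2) = ((2 : ℝ) ^ ((1 - a) / 2)) ^ k := by
    rw [← Real.rpow_natCast, ← Real.rpow_natCast, ← Real.rpow_mul (by norm_num),
      ← Real.rpow_mul (by norm_num), mul_comm]
  rwa [e]

theorem abs_resonance_phase_le {β γ r X : ℝ} {j : Fin d} (hr0 : 0 < r)
    (hr : 100 * (1 + |γ| + |β - γ|) * r ≤ 1) (hX : 1 ≤ X) {w z : Space d} {t : ℝ}
    (ht0 : 0 ≤ t) (ht1 : t ≤ 1)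
    (hw : ‖w - EuclideanSpace.single j (X / (2 * Real.pi))‖ ≤ r)
    (hz : ‖z‖ ≤ r) (hzj : |z j| ≤ r / X) :
    |t * ((2 * Real.pi) ^ 2 * ((β - γ) * ‖z‖ ^ 2 - 2 * γ * inner ℝ w z))| ≤ 1 := by
  have hpi := Real.pi_pos
  have hpi2 : Real.pi < 3.15 := Real.pi_lt_d2
  set κ : ℝ := 2 * Real.pi with hκ
  have hκ0 : 0 < κ := by positivity
  have hκ1 : κ ≤ 6.3 := by linarith
  have hγr : |γ| * r ≤ 1 / 100 := by nlinarith [mul_nonneg (abs_nonneg (β - γ)) hr0.le]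
  have hβr : |β - γ| * r ≤ 1 / 100 := by nlinarith [mul_nonneg (abs_nonneg γ) hr0.le]
  have hr1 : r ≤ 1 / 100 := by
    nlinarith [mul_nonneg (abs_nonneg (β - γ)) hr0.le, mul_nonneg (abs_nonneg γ) hr0.le]
  have hin : |inner ℝ w z| ≤ r / κ + r ^ 2 := by
    -- The main part of `w` sees only `z_j`, where the slab width `r / X` compensates the size `X`;
    -- the remainder of `w` and `z` itself both have length at most `r`.
    have e : inner ℝ w z = X / κ * z j +
        inner ℝ (w - EuclideanSpace.single j (X / κ)) z := by
      rw [inner_sub_left, EuclideanSpace.inner_single_left]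
      simp
    rw [e]
    refine (abs_add_le _ _).trans (add_le_add ?_ ?_)
    · rw [abs_mul, abs_of_pos (by positivity)]
      calc X / κ * |z j| ≤ X / κ * (r / X) := by gcongr
        _ = r / κ := by field_simp
    · refine (abs_real_inner_le_norm _ _).trans ?_
      rw [pow_two]
      exact mul_le_mul hw hz (norm_nonneg _) hr0.le
  have hz2 : ‖z‖ ^ 2 ≤ r ^ 2 := pow_le_pow_left₀ (norm_nonneg _) hz 2
  have h1 : |(β - γ) * ‖z‖ ^ 2 - 2 * γ * inner ℝ w z| ≤
      |β - γ| * r ^ 2 + 2 * |γ| * (r / κ + r ^ 2) := by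
    refine (abs_sub _ _).trans (add_le_add ?_ ?_)
    · rw [abs_mul, abs_of_nonneg (sq_nonneg ‖z‖)]
      gcongr
    · rw [abs_mul, abs_mul, abs_of_pos (two_pos)]
      gcongr
  rw [abs_mul, abs_of_nonneg ht0, abs_mul, abs_of_pos (by positivity : 0 < κ ^ 2)]
  have h2 : κ ^ 2 * (|β - γ| * r ^ 2 + 2 * |γ| * (r / κ + r ^ 2)) =
      κ ^ 2 * (|β - γ| * r * r) + 2 * κ * (|γ| * r) + 2 * κ ^ 2 * (|γ| * r * r) := by
    field_simp
    ring
  have hκ2 : κ ^ 2 ≤ 40 := by nlinarith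
  have h3 : |β - γ| * r * r ≤ 1 / 10000 := by nlinarith [mul_nonneg (abs_nonneg (β - γ)) hr0.le]
  have h4 : |γ| * r * r ≤ 1 / 10000 := by nlinarith [mul_nonneg (abs_nonneg γ) hr0.le]
  have h5 : κ ^ 2 * (|β - γ| * r * r) ≤ 40 * (1 / 10000) :=
    mul_le_mul hκ2 h3 (by positivity) (by norm_num)
  have h6 : κ ^ 2 * (|γ| * r * r) ≤ 40 * (1 / 10000) :=
    mul_le_mul hκ2 h4 (by positivity) (by norm_num)
  have h7 : κ * (|γ| * r) ≤ 6.3 * (1 / 100) :=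
    mul_le_mul hκ1 hγr (by positivity) (by norm_num)
  have h8 : κ ^ 2 * |(β - γ) * ‖z‖ ^ 2 - 2 * γ * inner ℝ w z| ≤ 1 := by
    refine (mul_le_mul_of_nonneg_left h1 (by positivity)).trans ?_
    rw [h2]
    linarith
  calc t * (κ ^ 2 * |(β - γ) * ‖z‖ ^ 2 - 2 * γ * inner ℝ w z|) ≤ 1 * 1 :=
        mul_le_mul ht1 h8 (by positivity) zero_le_one
    _ = 1 := one_mul 1

/-- Points near `(2π)⁻¹ X e_j` have frequency close to `X e_j`. -/
theorem norm_scaled_bounds {X r : ℝ} {j : Fin d} (hX : 1 ≤ X) (hr : r ≤ 1 / 50) {y : Space d}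
    (hy : ‖y - EuclideanSpace.single j (X / (2 * Real.pi))‖ ≤ r) :
    5 / 6 * X < ‖(2 * Real.pi) • y‖ ∧ ‖(2 * Real.pi) • y‖ ≤ 4 / 3 * X ∧
      X / 2 ≤ 2 * Real.pi * |y j| := by
  have hpi := Real.pi_pos
  have hpi2 : Real.pi < 3.15 := Real.pi_lt_d2
  have hX0 : 0 < X := by linarith
  set c : Space d := EuclideanSpace.single j (X / (2 * Real.pi)) with hc
  have hcn : ‖c‖ = X / (2 * Real.pi) := by
    rw [hc, PiLp.norm_single, Real.norm_of_nonneg (by positivity)]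
  have h1 : ‖y‖ ≤ ‖c‖ + r := by
    have := norm_add_le c (y - c)
    rw [add_sub_cancel] at this
    linarith
  have h2 : ‖c‖ - r ≤ ‖y‖ := by
    have := norm_sub_norm_le c y
    rw [norm_sub_rev] at this
    linarith
  have h3 : 2 * Real.pi * ‖c‖ = X := by rw [hcn]; field_simp
  have h4 : 2 * Real.pi * r < 1 / 6 * X := by nlinarith
  rw [norm_smul, Real.norm_of_nonneg (by positivity)]
  refine ⟨?_, ?_, ?_⟩
  · nlinarith
  · nlinarith
  · have h5 : |y j - X / (2 * Real.pi)| ≤ r := by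
      have := PiLp.norm_apply_le (y - c) j
      have e : (y - c) j = y j - X / (2 * Real.pi) := by simp [hc]
      rw [e, Real.norm_eq_abs] at this
      linarith
    have h6 := (abs_le.1 h5).1
    have h7 : X / (2 * Real.pi) - r ≤ |y j| := by linarith [le_abs_self (y j)]
    have h8 : 2 * Real.pi * (X / (2 * Real.pi) - r) ≤ 2 * Real.pi * |y j| := by gcongr
    have h9 : 2 * Real.pi * (X / (2 * Real.pi) - r) = X - 2 * Real.pi * r := by
      field_simp
    linarith

/-- Power count: `√V` cancels from both sides, and `√V ≥ √(v / X)`. The exponent left over is `1 -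
a/2 - 1/2 = (1 - a)/2`. -/
theorem final_inequality {C K T b₁ b₂ v V c X Y a : ℝ} (hT : 0 < T)
    (hv : 0 < v) (hb₁ : 0 < b₁) (hc : 0 < c) (hX : 1 ≤ X) (hY : 0 < Y)
    (hV : v / X ≤ V)
    (h : C * K ^ 2 * Real.sqrt b₂ * T⁻¹ <
      c * T / 4 * Real.sqrt b₁ * Real.sqrt v * X ^ ((1 - a) / 2)) :
    C * (Y * (K * Real.sqrt (X ^ a * T⁻¹)) * Real.sqrt b₂) *
        (K * Real.sqrt T⁻¹ * Real.sqrt V) <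
      c * Y * (X / 2 * (T / 2 * V)) * Real.sqrt b₁ := by
  have hX0 : 0 < X := by linarith
  have hV0 : 0 < V := lt_of_lt_of_le (by positivity) hV
  have hs1 : Real.sqrt (X ^ a * T⁻¹) * Real.sqrt T⁻¹ = X ^ (a / 2) * T⁻¹ := by
    rw [Real.sqrt_mul (by positivity), mul_assoc, Real.mul_self_sqrt (by positivity),
      Real.sqrt_eq_rpow, ← Real.rpow_mul hX0.le]
    congr 2
    ring
  have hs2 : Real.sqrt v ≤ X ^ (1 / 2 : ℝ) * Real.sqrt V := by
    rw [← Real.sqrt_eq_rpow, ← Real.sqrt_mul hX0.le]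
    exact Real.sqrt_le_sqrt (by rwa [div_le_iff₀' hX0] at hV)
  have hX2 : X ^ ((1 - a) / 2) * X ^ (a / 2) * X ^ (1 / 2 : ℝ) = X := by
    rw [← Real.rpow_add hX0, ← Real.rpow_add hX0]
    have : (1 - a) / 2 + a / 2 + 1 / 2 = 1 := by ring
    rw [this, Real.rpow_one]
  have hpos : 0 < X ^ (a / 2) * Real.sqrt V * Y := by positivity
  calc C * (Y * (K * Real.sqrt (X ^ a * T⁻¹)) * Real.sqrt b₂) * (K * Real.sqrt T⁻¹ * Real.sqrt V)
      = C * K ^ 2 * Real.sqrt b₂ * (Real.sqrt (X ^ a * T⁻¹) * Real.sqrt T⁻¹) *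
          Real.sqrt V * Y := by ring
    _ = C * K ^ 2 * Real.sqrt b₂ * T⁻¹ * (X ^ (a / 2) * Real.sqrt V * Y) := by rw [hs1]; ring
    _ < c * T / 4 * Real.sqrt b₁ * Real.sqrt v * X ^ ((1 - a) / 2) *
          (X ^ (a / 2) * Real.sqrt V * Y) := mul_lt_mul_of_pos_right h hpos
    _ ≤ c * T / 4 * Real.sqrt b₁ * (X ^ (1 / 2 : ℝ) * Real.sqrt V) * X ^ ((1 - a) / 2) *
          (X ^ (a / 2) * Real.sqrt V * Y) := by gcongr
    _ = c * T / 4 * Real.sqrt b₁ * (X ^ ((1 - a) / 2) * X ^ (a / 2) * X ^ (1 / 2 : ℝ)) *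
          (Real.sqrt V * Real.sqrt V) * Y := by ring
    _ = c * Y * (X / 2 * (T / 2 * V)) * Real.sqrt b₁ := by
        rw [hX2, Real.mul_self_sqrt hV0.le]
        ring

end ShortTime

end

/-! ### The counterexample -/

theorem mainTheorem9 (η : ℝ → ℝ) (hη : ShortTime.IsBump η)
    (d : ℕ) (α β γ : ℝ) (hα : α ≠ 0) (hβ : β ≠ 0) (hγ : γ ≠ 0)
    (hαγ : α - γ = 0) (hβγ : β + γ ≠ 0)
    (a : ℝ) (ha0 : 0 < a) (ha1 : a < 1) (s : ℝ) (T : ℝ) (hT0 : 0 < T) (hT1 : T ≤ 1)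
    (j : Fin d) (C : ℝ) (hC : 0 < C) (k₀ : ℕ) :
    ∃ k : ℕ, k₀ ≤ k ∧ ∃ (f g : ℝ → ShortTime.L2 d) (D : ℝ → 𝓢'(ShortTime.Space d, ℂ)),
      ContinuousOn f (Icc 0 T) ∧ ContinuousOn g (Icc 0 T) ∧
      ShortTime.FreqSupported T k f ∧ ShortTime.FreqSupported T 0 g ∧
      ShortTime.MemF η s a α T (ShortTime.toDist f) ∧
      ShortTime.MemF η s a β T (ShortTime.toDist g) ∧
      (∀ t ∈ Icc 0 T, ShortTime.IsDuhamel γ j f g t (D t)) ∧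
      (⨆ t ∈ Icc 0 T, ShortTime.sobolevNorm s (D t)) < ⊤ ∧
      ENNReal.ofReal C * ShortTime.fNorm η s a α T (ShortTime.toDist f) *
          ShortTime.fNorm η s a β T (ShortTime.toDist g) <
        ⨆ t ∈ Icc 0 T, ShortTime.sobolevNorm s (D t) := by
  obtain rfl : α = γ := sub_eq_zero.1 hαγ
  have hpi := Real.pi_pos
  have hpi2 : Real.pi < 3.15 := Real.pi_lt_d2
  obtain ⟨K, hK0, hK⟩ := hη.exists_fNorm_free_le d
  -- The radius is fixed before `k`, so `v`, `b₁` and `b₂` below do not depend on the frequency; it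
  -- is small enough for the phase bound and for `A` to stay on the plateau of `ψ_N`.
  set r : ℝ := (100 * (1 + |α| + |β - α|))⁻¹ with hr
  have hr0 : 0 < r := by positivity
  have hrA : 100 * (1 + |α| + |β - α|) * r ≤ 1 := (mul_inv_cancel₀ (by positivity)).le
  have hr1 : r ≤ 1 / 100 := by
    nlinarith [mul_nonneg (abs_nonneg (β - α)) hr0.le, mul_nonneg (abs_nonneg α) hr0.le]
  obtain ⟨v, hv0, hv⟩ := ShortTime.exists_slab_volume_ge j hr0
  set b₁ : ℝ := volume.real (Metric.ball (0 : ShortTime.Space d) r) with hb₁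
  set b₂ : ℝ := volume.real (Metric.ball (0 : ShortTime.Space d) (2 * r)) with hb₂
  have hb₁0 : 0 < b₁ := ENNReal.toReal_pos (Metric.measure_ball_pos volume _ hr0).ne'
    measure_ball_lt_top.ne
  set c : ℝ := (4 : ℝ) ^ (-(|s| / 2)) with hc
  have hc0 : 0 < c := by positivity
  obtain ⟨k, hk₀, hk⟩ := ShortTime.exists_growth ha1 (C * K ^ 2 * Real.sqrt b₂ * T⁻¹)
    (E' := c * T / 4 * Real.sqrt b₁ * Real.sqrt v) (by positivity) k₀
  set X : ℝ := (2 : ℝ) ^ k with hX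
  have hX1 : 1 ≤ X := one_le_pow₀ (by norm_num)
  have hX0 : 0 < X := by linarith
  set ctr : ShortTime.Space d := EuclideanSpace.single j (X / (2 * Real.pi)) with hctr
  -- The radius of `A` is doubled so that `w + z ∈ A` for every `w ∈ A'` and `z ∈ B`.
  set A : Set (ShortTime.Space d) := Metric.ball ctr (2 * r) with hA
  set A' : Set (ShortTime.Space d) := Metric.ball ctr r with hA'
  set B : Set (ShortTime.Space d) := Metric.ball 0 r ∩ {z | |z j| ≤ r / X} with hB
  have hBm : MeasurableSet B := measurableSet_ball.inter
    (measurableSet_le (by fun_prop) measurable_const)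
  have hBf : volume B ≠ ⊤ := ((measure_mono inter_subset_left).trans_lt measure_ball_lt_top).ne
  have hbound : ∀ R : ℝ, ∀ y ∈ Metric.ball ctr R, ‖y‖ ≤ 1 + (‖ctr‖ + |R|) := fun R y hy => by
    have h1 := norm_add_le ctr (y - ctr)
    rw [add_sub_cancel] at h1
    have h2 := (mem_ball_iff_norm.1 hy).le.trans (le_abs_self R)
    linarith
  have hFA : ShortTime.IsBddSupp (A.indicator fun _ => (1 : ℂ)) :=
    ShortTime.isBddSupp_indicator measurableSet_ball
      (le_add_of_nonneg_right (by positivity)) (hbound (2 * r))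
  have hFA' : ShortTime.IsBddSupp (A'.indicator fun _ => (1 : ℂ)) :=
    ShortTime.isBddSupp_indicator measurableSet_ball
      (le_add_of_nonneg_right (by positivity)) (hbound r)
  have hGB : ShortTime.IsBddSupp (B.indicator fun _ => (1 : ℂ)) :=
    ShortTime.isBddSupp_indicator hBm le_rfl fun y hy =>
      (mem_ball_zero_iff.1 hy.1).le.trans (by linarith)
  have hcoreA : ShortTime.InCore k (A.indicator fun _ => (1 : ℂ)) := fun y hy => by
    have h1 : ‖y - ctr‖ ≤ 2 * r :=
      (mem_ball_iff_norm.1 (mem_of_indicator_ne_zero hy)).le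
    obtain ⟨h2, h3, -⟩ := ShortTime.norm_scaled_bounds hX1 (by linarith) h1
    exact ⟨Or.inr h2, h3⟩
  have hcoreB : ShortTime.InCore 0 (B.indicator fun _ => (1 : ℂ)) := fun y hy => by
    have h1 : ‖y‖ < r := mem_ball_zero_iff.1 (mem_of_indicator_ne_zero hy).1
    refine ⟨Or.inl rfl, ?_⟩
    rw [norm_smul, Real.norm_of_nonneg (by positivity), pow_zero]
    nlinarith [norm_nonneg y]
  obtain ⟨hmf, hnf⟩ := hK a ha0 T hT0 hT1 s α k _ hFA hcoreA
  obtain ⟨hmg, hng⟩ := hK a ha0 T hT0 hT1 s β 0 _ hGB hcoreB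
  have hVA : volume.real A = b₂ := by
    rw [hA, hb₂, measureReal_def, measureReal_def, Measure.addHaar_ball_center]
  have hVA' : volume.real A' = b₁ := by
    rw [hA', hb₁, measureReal_def, measureReal_def, Measure.addHaar_ball_center]
  rw [ShortTime.enorm_synth_indicator measurableSet_ball hFA measure_ball_lt_top.ne, hVA,
    ← ENNReal.ofReal_mul (by positivity)] at hnf
  rw [ShortTime.enorm_synth_indicator hBm hGB hBf, ← ENNReal.ofReal_mul (by positivity), pow_zero,
    Real.one_rpow, Real.one_rpow, one_mul, one_mul] at hng
  set W := ShortTime.duhamelHat α β α j (A.indicator fun _ => (1 : ℂ))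
    (B.indicator fun _ => (1 : ℂ)) with hW
  have hWT := ShortTime.isBddSupp_duhamelHat (α := α) (β := β) (γ := α) (j := j) hFA hGB
    hT0.le hT1
  refine ⟨k, hk₀, ShortTime.free α (A.indicator fun _ => 1), ShortTime.free β
    (B.indicator fun _ => 1), fun t => ((ShortTime.synth (W t) : ShortTime.L2 d) :
      𝓢'(ShortTime.Space d, ℂ)), (ShortTime.continuous_free α hFA).continuousOn,
    (ShortTime.continuous_free β hGB).continuousOn,
    ShortTime.freqSupported_free hFA (fun y hy => hcoreA.mem_freqRegion hy) α T,
    ShortTime.freqSupported_free hGB (fun y hy => hcoreB.mem_freqRegion hy) β T, hmf, hmg,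
    fun t ht => ShortTime.isDuhamel_synth hFA hGB ht.1 (ht.2.trans hT1),
    ShortTime.iSup_sobolevNorm_duhamel_lt_top hFA hGB s hT1, ?_⟩
  have hlow : ENNReal.ofReal (c * X ^ s * (X / 2 * (T / 2 * volume.real B)) * Real.sqrt b₁) ≤
      ShortTime.sobolevNorm s ((ShortTime.synth (W T) : ShortTime.L2 d) :
        𝓢'(ShortTime.Space d, ℂ)) := by
    rw [ShortTime.sobolevNorm_synth hWT, ← hVA']
    have hV0 : 0 < volume.real B := lt_of_lt_of_le (by positivity) (hv X hX1)
    refine ShortTime.le_enorm_synth measurableSet_ball hFA' measure_ball_lt_top.ne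
      (hWT.mul_continuous (ShortTime.hasTemperateGrowth_bessel s).1.continuous) (by positivity)
      fun w hw => ?_
    have hw' : ‖w - ctr‖ ≤ r := (mem_ball_iff_norm.1 hw).le
    obtain ⟨h1, h2, h3⟩ := ShortTime.norm_scaled_bounds hX1 (by linarith) hw'
    rw [norm_mul, Complex.norm_real, Real.norm_of_nonneg (by positivity)]
    refine mul_le_mul (ShortTime.bessel_weight_ge s hX1 (by linarith) h2) ?_ (by positivity)
      (by positivity)
    refine le_trans ?_ (ShortTime.norm_duhamelHat_ge hBm hBf hT0.le (fun z hz => ?_)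
      fun t' ht' z hz => ?_)
    · gcongr
    · rw [hA, mem_ball_iff_norm, add_sub_right_comm]
      have h4 := mem_ball_zero_iff.1 hz.1
      have h5 := norm_add_le (w - ctr) z
      linarith
    · exact ShortTime.half_le_re_resonance (ShortTime.abs_resonance_phase_le hr0 hrA hX1 ht'.1.le
        (ht'.2.trans hT1) hw' (mem_ball_zero_iff.1 hz.1).le hz.2)
  -- The supremum is bounded below by its value at the endpoint `t = T`, where the coherent time
  -- integral was estimated.
  refine lt_of_lt_of_le ?_ (hlow.trans (le_iSup₂_of_le T ⟨hT0.le, le_rfl⟩ le_rfl))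
  refine lt_of_le_of_lt (mul_le_mul' (mul_le_mul' le_rfl hnf) hng) ?_
  rw [← ENNReal.ofReal_mul (by positivity), ← ENNReal.ofReal_mul (by positivity)]
  have hfin := ShortTime.final_inequality (Y := X ^ s) hT0 hv0 hb₁0 hc0 hX1 (by positivity)
    (hv X hX1) hk
  exact (ENNReal.ofReal_lt_ofReal_iff_of_nonneg (by positivity)).2 hfin
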